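/- Let $\mathbb{R}_{\max}=\mathbb{R}\cup\{-\infty\}$. For $n\ge 1$ and matrices $L,C,R\in\mathbb{R}_{\max}^{n\times n}$ put $X_{-1}=L$, $X_0=C$, $X_{1}=R$, and let $\mathcal{G}_{\mathbb{N}}(L,C,R)$ be the weighted directed graph with node set $\{1,\dots,n\}\times\{1,2,3,\dots\}$ that has an arc from $(i,k)$ to $(j,k+s)$, of weight $(X_s)_{ji}$, for all nodes $(i,k)$, $(j,k+s)$ with $s\in\{-1,0,1\}$ and $(X_s)_{ji}\neq-\infty$. The weight of a path (a finite sequence of at least one consecutive arcs; nodes may repeat) is the sum of the weights of its arcs. The graph contains an $\infty$-weight path if, for some nodes $u$ and $v$, there is a sequence of paths from $u$ to $v$ whose weights tend to $+\infty$. The decision problem $\infty$-WEIGHT $\mathbb{N}$-PATH asks, given $L,C,R\in\mathbb{R}_{\max}^{n\times n}$, whether $\mathcal{G}_{\mathbb{N}}(L,C,R)$ contains an $\infty$-weight path. **Theorem.** The problem $\infty$-WEIGHT $\mathbb{N}$-PATH is solvable in strongly polynomial time $O(n^5)$. That is, in the arithmetic model of computation, in which each elementary operation takes one unit of time, there are a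 single program and a constant $K$ such that for every $n\ge1$ and all $L,C,R\in\mathbb{R}_{\max}^{n\times n}$ the program halts after at most $Kn^5$ steps with the correct answer; moreover, when all entries of $L,C,R$ lie in $\mathbb{Q}\cup\{-\infty\}$, all numbers occurring in the computation are rational (or $-\infty$) and have encoding length bounded by a polynomial in the encoding length of the instance. Here the machine has natural-number index registers and two-dimensional arrays of elements of $\mathbb{R}_{\max}$; its only elementary operations are copying, loading a constant ($0$ or $-\infty$ for array elements), addition and comparison, and (on indices only) truncated subtraction, together with sequencing, branching and loops. -/

import Mathlib

/-! ## Weighted directed graphs, paths and infinite-weight paths -/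

/-- A weighted directed graph on the node set `V`: a set of arcs and a real weight for every arc. -/
structure WeightedDigraph (V : Type*) where
  /-- `Arc u v`: there is an arc from `u` to `v`. -/
  Arc : V → V → Prop
  /-- the weight of an arc -/
  weight : ∀ u v : V, Arc u v → ℝ

namespace WeightedDigraph

variable {V : Type*}

/-- Paths of length at least one from a node to a node; nodes and arcs may be repeated. -/
inductive Path (G : WeightedDigraph V) : V → V → Type _
  | single {u v : V} (h : G.Arc u v) : Path G u v
  | cons {u v z : V} (h : G.Arc u v) (p : Path G v z) : Path G u z

/-- The weight of a path: the sum of the weights of its arcs. -/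
def Path.weight {G : WeightedDigraph V} : {u v : V} → G.Path u v → ℝ
  | u, v, .single h => G.weight u v h
  | u, _, .cons (v := v) h p => G.weight u v h + p.weight

/-- `G` contains an `∞`-weight path: for some nodes `u` and `v` there is a sequence of paths from
`u` to `v` whose weights tend to `+∞`. -/
def HasInfWeightPath (G : WeightedDigraph V) : Prop :=
  ∃ u v : V, ∃ p : ℕ → G.Path u v,
    Filter.Tendsto (fun h => (p h).weight) Filter.atTop Filter.atTop

end WeightedDigraph

/-! ## Static graphs and periodic graphs -/

/-- `n × n` matrices over `ℝ_max = ℝ ∪ {-∞}`; the bottom element is `-∞`. -/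
abbrev RmaxMatrix (n : ℕ) : Type := Matrix (Fin n) (Fin n) (WithBot ℝ)

/-- The matrix `X_s`: it is `L`, `C`, `R` for `s = -1, 0, 1`; for all other shifts there are no
arcs. -/
def shiftMatrix {n : ℕ} (L C R : RmaxMatrix n) (s : ℤ) : RmaxMatrix n :=
  if s = -1 then L else if s = 0 then C else if s = 1 then R else fun _ _ => ⊥

/-- The static graph has an arc from `i` to `j` with shift `s` iff `(X_s)_{ji} ≠ -∞`. -/
def StaticArc {n : ℕ} (L C R : RmaxMatrix n) (i : Fin n) (s : ℤ) (j : Fin n) : Prop :=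
  shiftMatrix L C R s j i ≠ ⊥

/-- The weight `(X_s)_{ji}` of an arc `(i, s, j)` of the static graph. -/
def staticWeight {n : ℕ} (L C R : RmaxMatrix n) (i : Fin n) (s : ℤ) (j : Fin n)
    (h : StaticArc L C R i s j) : ℝ :=
  (shiftMatrix L C R s j i).unbot h

/-- The `S`-periodic graph induced by the static graph of `L, C, R`: its nodes are the pairs
`(i, k)` with `k ∈ S`, and each arc `(i, s, j)` of the static graph yields an arc from `(i, k)` to
`(j, k + s)` of the same weight whenever `k, k + s ∈ S`. -/
def periodicGraph (S : Set ℤ) {n : ℕ} (L C R : RmaxMatrix n) : WeightedDigraph (Fin n × S) where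
  Arc u v := StaticArc L C R u.1 ((v.2 : ℤ) - (u.2 : ℤ)) v.1
  weight u v h := staticWeight L C R u.1 ((v.2 : ℤ) - (u.2 : ℤ)) v.1 h

/-- The question of the decision problem `∞`-WEIGHT `ℕ`-PATH for the instance `L, C, R`: does the
`ℕ`-periodic graph (shifts `1, 2, 3, …`) contain an `∞`-weight path? -/
def InfWeightNPath {n : ℕ} (L C R : RmaxMatrix n) : Prop :=
  (periodicGraph (Set.Ici (1 : ℤ)) L C R).HasInfWeightPath

/-! ## The arithmetic model of computation

A random access machine with natural-number index registers and two-dimensional arrays whose cells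
hold elements of `ℝ ∪ {-∞}`. A program is a fixed finite piece of code, the same for all inputs.
Each elementary operation takes one step. On cells the only operations are copying, loading `0` or
`-∞`, addition, and comparison; on indices, loading a constant, addition, truncated subtraction and
comparison. There is no multiplication, and no conversion of cells into indices. -/

namespace ArithRAM

/-- A cell reference `A[i][j]` in a program: the array `name`, at the position given by the current
contents of the index registers `row` and `col`. -/
structure Cell where
  name : ℕ
  row : ℕ
  col : ℕ

/-- The tests: strict comparison of two index registers, comparison of two cells. -/
inductive Test
  | regLt (r s : ℕ)
  | cellLe (x y : Cell)

/-- Programs. -/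
inductive Prog
  | skip
  /-- register `r` := the number `k` -/
  | regConst (r k : ℕ)
  /-- register `r` := register `s` + register `t` -/
  | regAdd (r s t : ℕ)
  /-- register `r` := register `s` - register `t`, truncated at `0` -/
  | regSub (r s t : ℕ)
  /-- `x := 0` -/
  | cellZero (x : Cell)
  /-- `x := -∞` -/
  | cellBot (x : Cell)
  /-- `x := y` -/
  | cellCopy (x y : Cell)
  /-- `x := y + z` -/
  | cellAdd (x y z : Cell)
  | seq (P Q : Prog)
  | ite (b : Test) (P Q : Prog)
  | while (b : Test) (P : Prog)

/-- The memory of the machine. -/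
structure Memory where
  reg : ℕ → ℕ
  arr : ℕ → ℕ → ℕ → WithBot ℝ

/-- The content of a cell. -/
def Memory.get (σ : Memory) (x : Cell) : WithBot ℝ :=
  σ.arr x.name (σ.reg x.row) (σ.reg x.col)

/-- Writing into a cell. -/
def Memory.set (σ : Memory) (x : Cell) (v : WithBot ℝ) : Memory where
  reg := σ.reg
  arr := fun a i j =>
    if a = x.name ∧ i = σ.reg x.row ∧ j = σ.reg x.col then v else σ.arr a i j

/-- Writing into an index register. -/
def Memory.setReg (σ : Memory) (r k : ℕ) : Memory where
  reg := Function.update σ.reg r k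
  arr := σ.arr

/-- The truth of a test. -/
def Test.Holds (σ : Memory) : Test → Prop
  | .regLt r s => σ.reg r < σ.reg s
  | .cellLe x y => σ.get x ≤ σ.get y

/-- A configuration: the pieces of code that remain to be executed, and the memory. -/
structure Config where
  code : List Prog
  mem : Memory

/-- One step of the machine. A configuration without remaining code has halted. -/
noncomputable def step : Config → Config
  | ⟨[], σ⟩ => ⟨[], σ⟩
  | ⟨.skip :: l, σ⟩ => ⟨l, σ⟩
  | ⟨.regConst r k :: l, σ⟩ => ⟨l, σ.setReg r k⟩
  | ⟨.regAdd r s t :: l, σ⟩ => ⟨l, σ.setReg r (σ.reg s + σ.reg t)⟩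
  | ⟨.regSub r s t :: l, σ⟩ => ⟨l, σ.setReg r (σ.reg s - σ.reg t)⟩
  | ⟨.cellZero x :: l, σ⟩ => ⟨l, σ.set x 0⟩
  | ⟨.cellBot x :: l, σ⟩ => ⟨l, σ.set x ⊥⟩
  | ⟨.cellCopy x y :: l, σ⟩ => ⟨l, σ.set x (σ.get y)⟩
  | ⟨.cellAdd x y z :: l, σ⟩ => ⟨l, σ.set x (σ.get y + σ.get z)⟩
  | ⟨.seq P Q :: l, σ⟩ => ⟨P :: Q :: l, σ⟩
  | ⟨.ite b P Q :: l, σ⟩ =>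
      open Classical in if b.Holds σ then ⟨P :: l, σ⟩ else ⟨Q :: l, σ⟩
  | ⟨.while b P :: l, σ⟩ =>
      open Classical in if b.Holds σ then ⟨P :: .while b P :: l, σ⟩ else ⟨l, σ⟩

/-- The initial memory on input `n, L, C, R`: index register `0` holds `n`, all others hold `0`;
the arrays `0`, `1`, `2` hold `L`, `C`, `R`, and all remaining cells hold `-∞`. -/
def initMemory {n : ℕ} (L C R : RmaxMatrix n) : Memory where
  reg := fun r => if r = 0 then n else 0
  arr := fun a i j =>
    if h : i < n ∧ j < n then
      if a = 0 then L ⟨i, h.1⟩ ⟨j, h.2⟩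
      else if a = 1 then C ⟨i, h.1⟩ ⟨j, h.2⟩
      else if a = 2 then R ⟨i, h.1⟩ ⟨j, h.2⟩
      else ⊥
    else ⊥

/-- The configuration after `t` steps of the program `P` on input `n, L, C, R`. -/
noncomputable def run (P : Prog) {n : ℕ} (L C R : RmaxMatrix n) (t : ℕ) : Config :=
  step^[t] ⟨[P], initMemory L C R⟩

/-- `P` decides the problem `Q` on triples of `n × n` matrices over `ℝ ∪ {-∞}`, `n ≥ 1`, within
`T n` steps: it halts in time, with `1` (yes) or `0` (no) in index register `0`. -/
def DecidesWithin (P : Prog) (Q : ∀ n : ℕ, RmaxMatrix n → RmaxMatrix n → RmaxMatrix n → Prop)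
    (T : ℕ → ℕ) : Prop :=
  ∀ n : ℕ, 1 ≤ n → ∀ L C R : RmaxMatrix n, ∃ t ≤ T n,
    (run P L C R t).code = [] ∧
    (Q n L C R → (run P L C R t).mem.reg 0 = 1) ∧
    (¬ Q n L C R → (run P L C R t).mem.reg 0 = 0)

/-! ### Encoding lengths for rational data -/

/-- Encoding length of an element of `ℚ ∪ {-∞}`. -/
def encodingLength : WithBot ℚ → ℕ
  | ⊥ => 1
  | (q : ℚ) => 1 + q.num.natAbs.size + q.den.size

/-- The total encoding length of an instance with entries in `ℚ ∪ {-∞}`. -/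
def instanceLength {n : ℕ} (L C R : Matrix (Fin n) (Fin n) (WithBot ℚ)) : ℕ :=
  ∑ i, ∑ j, (encodingLength (L i j) + encodingLength (C i j) + encodingLength (R i j))

/-- The inclusion of `ℚ ∪ {-∞}` in `ℝ ∪ {-∞}`. -/
def ratToRmax : WithBot ℚ → WithBot ℝ := WithBot.map (fun q : ℚ => (q : ℝ))

/-- On rational instances, all numbers that occur in a run of `P` have encoding length polynomial
in the encoding length of the instance. Together with a polynomial bound on the number of steps
this says that `P` works in polynomial space on rational instances. -/
def HasPolynomialNumbers (P : Prog) : Prop :=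
  ∃ p : Polynomial ℕ, ∀ n : ℕ, 1 ≤ n → ∀ L C R : Matrix (Fin n) (Fin n) (WithBot ℚ), ∀ t : ℕ,
    (∀ r : ℕ, ((run P (L.map ratToRmax) (C.map ratToRmax) (R.map ratToRmax) t).mem.reg r).size
        ≤ p.eval (instanceLength L C R)) ∧
    (∀ a i j : ℕ, ∃ q : WithBot ℚ,
      (run P (L.map ratToRmax) (C.map ratToRmax) (R.map ratToRmax) t).mem.arr a i j
          = ratToRmax q ∧
        encodingLength q ≤ p.eval (instanceLength L C R))

end ArithRAM

/-! The criterion asks for nodes `i`, `j` of the static graph, a walk from `i` to `j`, a closed walk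
at `i` of shift `s₁ ≥ 0` and weight `w₁`, and a closed walk at `j` of shift `-s₂ ≤ 0` and weight
`w₂`, with `s₂ w₁ + s₁ w₂ > 0`. A closed walk whose coefficient is zero may be missing.

Sufficiency (`infWeightNPath_of_walks`) is pumping: climb with `m s₂` turns at `i`, cross over to
`j`, descend with `m s₁` turns. The endpoints do not depend on `m`, and the weight grows linearly in
`m`.

Necessity (`not_infWeightNPath`) is duality. If no combination of closed walks of length at most `n`
is positive, there are slopes `lam` that increase along arcs and separate the gain rates of
ascending closed walks upstream from the loss rates of descending closed walks downstream
(`exists_slope`). Subtracting them leaves no positive short closed walk, so a correction `h` exists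
(`exists_periodic_potential`), and `lam i * k + h i` is a potential on the half-line that bounds the
weight of every path by its endpoints.

To evaluate the criterion, `n` rounds of Bellman-Ford relaxation, indexed by source, target and
shift, produce entries that dominate all walks of length at most `n` and are themselves weights of
walks (`computeWalks_does`). A round costs `O(n^4)`. The `O(n^4)` choices of `i, j, s₁, s₂` are then
tested in `O(n)` steps each, the multiples being formed by repeated addition (`testAll_does`).

Number sizes need no inspection of the program: without multiplication, numbers over a common
denominator at most double per step, so a polynomial running time already bounds their length
(`DecidesWithin.hasPolynomialNumbers`). -/

namespace ArithRAM

/-! ### A timed program logic for the machine -/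

/-- Started on `P` and memory `σ`, the machine finishes `P` within `T` steps, in a memory that
satisfies `Q`. -/
def Does (P : Prog) (σ : Memory) (T : ℕ) (Q : Memory → Prop) : Prop :=
  ∃ τ t, t ≤ T ∧ (∀ l, step^[t] ⟨P :: l, σ⟩ = ⟨l, τ⟩) ∧ Q τ

namespace Does

variable {P P' : Prog} {σ : Memory} {T T' : ℕ} {Q Q' : Memory → Prop}

theorem mono (h : Does P σ T Q) (hT : T ≤ T') (hQ : ∀ τ, Q τ → Q' τ) : Does P σ T' Q' := by
  obtain ⟨τ, t, ht, hs, hq⟩ := h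
  exact ⟨τ, t, ht.trans hT, hs, hQ τ hq⟩

theorem le (h : Does P σ T Q) (hT : T ≤ T') : Does P σ T' Q := h.mono hT fun _ => id

theorem skip (h : Q σ) : Does .skip σ 1 Q := ⟨_, 1, le_rfl, fun _ => rfl, h⟩

theorem regConst {r k : ℕ} (h : Q (σ.setReg r k)) : Does (.regConst r k) σ 1 Q :=
  ⟨_, 1, le_rfl, fun _ => rfl, h⟩

theorem regAdd {r s t : ℕ} (h : Q (σ.setReg r (σ.reg s + σ.reg t))) :
    Does (.regAdd r s t) σ 1 Q := ⟨_, 1, le_rfl, fun _ => rfl, h⟩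

theorem regSub {r s t : ℕ} (h : Q (σ.setReg r (σ.reg s - σ.reg t))) :
    Does (.regSub r s t) σ 1 Q := ⟨_, 1, le_rfl, fun _ => rfl, h⟩

theorem cellZero {x : Cell} (h : Q (σ.set x 0)) : Does (.cellZero x) σ 1 Q :=
  ⟨_, 1, le_rfl, fun _ => rfl, h⟩

theorem cellBot {x : Cell} (h : Q (σ.set x ⊥)) : Does (.cellBot x) σ 1 Q :=
  ⟨_, 1, le_rfl, fun _ => rfl, h⟩

theorem cellCopy {x y : Cell} (h : Q (σ.set x (σ.get y))) : Does (.cellCopy x y) σ 1 Q :=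
  ⟨_, 1, le_rfl, fun _ => rfl, h⟩

theorem cellAdd {x y z : Cell} (h : Q (σ.set x (σ.get y + σ.get z))) :
    Does (.cellAdd x y z) σ 1 Q := ⟨_, 1, le_rfl, fun _ => rfl, h⟩

theorem seq (h : Does P σ T fun τ => Does P' τ T' Q) : Does (.seq P P') σ (T + T' + 1) Q := by
  obtain ⟨τ, t, ht, hs, τ', t', ht', hs', hq⟩ := h
  refine ⟨τ', t' + (t + 1), by omega, fun l => ?_, hq⟩
  rw [Function.iterate_add_apply, Function.iterate_add_apply, Function.iterate_one]
  change step^[t'] (step^[t] ⟨P :: P' :: l, σ⟩) = _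
  rw [hs, hs']

theorem ite {b : Test} (h : b.Holds σ → Does P σ T Q) (h' : ¬ b.Holds σ → Does P' σ T Q) :
    Does (.ite b P P') σ (T + 1) Q := by
  by_cases hb : b.Holds σ
  · obtain ⟨τ, t, ht, hs, hq⟩ := h hb
    refine ⟨τ, t + 1, by omega, fun l => ?_, hq⟩
    rw [Function.iterate_succ_apply, step, if_pos hb, hs]
  · obtain ⟨τ, t, ht, hs, hq⟩ := h' hb
    refine ⟨τ, t + 1, by omega, fun l => ?_, hq⟩
    rw [Function.iterate_succ_apply, step, if_neg hb, hs]

theorem while_of_not {b : Test} (hb : ¬ b.Holds σ) (h : Q σ) : Does (.while b P) σ 1 Q := by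
  refine ⟨σ, 1, le_rfl, fun l => ?_, h⟩
  rw [Function.iterate_one, step, if_neg hb]

theorem while_of {b : Test} (hb : b.Holds σ) (h : Does P σ T fun τ => Does (.while b P) τ T' Q) :
    Does (.while b P) σ (T + T' + 1) Q := by
  obtain ⟨τ, t, ht, hs, τ', t', ht', hs', hq⟩ := h
  refine ⟨τ', t' + (t + 1), by omega, fun l => ?_, hq⟩
  rw [Function.iterate_add_apply, Function.iterate_succ_apply, step, if_pos hb, hs, hs']

end Does

@[simp] theorem Memory.setReg_reg_self (σ : Memory) (r k : ℕ) : (σ.setReg r k).reg r = k := by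
  simp [Memory.setReg]

theorem Memory.setReg_reg_of_ne (σ : Memory) {r s : ℕ} (k : ℕ) (h : s ≠ r) :
    (σ.setReg r k).reg s = σ.reg s := by
  simp [Memory.setReg, h]

@[simp] theorem Memory.setReg_arr (σ : Memory) (r k : ℕ) : (σ.setReg r k).arr = σ.arr := rfl

@[simp] theorem Memory.set_reg (σ : Memory) (x : Cell) (v : WithBot ℝ) :
    (σ.set x v).reg = σ.reg := rfl

theorem Memory.set_arr_of_ne (σ : Memory) (x : Cell) (v : WithBot ℝ) {a : ℕ} (h : a ≠ x.name) :
    (σ.set x v).arr a = σ.arr a := by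
  funext i j
  simp [Memory.set, h]

theorem Memory.set_arr_name (σ : Memory) (x : Cell) (v : WithBot ℝ) (i j : ℕ) :
    (σ.set x v).arr x.name i j = if i = σ.reg x.row ∧ j = σ.reg x.col then v
      else σ.arr x.name i j := by
  simp [Memory.set]

/-- The registers below `b` have the same contents in both memories. -/
def Agree (b : ℕ) (σ τ : Memory) : Prop := ∀ r < b, τ.reg r = σ.reg r

theorem Agree.refl (b : ℕ) (σ : Memory) : Agree b σ σ := fun _ _ => rfl

theorem Agree.trans {b : ℕ} {σ τ υ : Memory} (h : Agree b σ τ) (h' : Agree b τ υ) :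
    Agree b σ υ := fun r hr => (h' r hr).trans (h r hr)

theorem Agree.anti {b c : ℕ} {σ τ : Memory} (h : Agree c σ τ) (hbc : b ≤ c) : Agree b σ τ :=
  fun r hr => h r (hr.trans_le hbc)

theorem Agree.setReg {b r : ℕ} {σ τ : Memory} (h : Agree b σ τ) (hr : b ≤ r) (k : ℕ) :
    Agree b σ (τ.setReg r k) := fun s hs => by
  rw [Memory.setReg_reg_of_ne _ _ (by omega), h s hs]

theorem Agree.set {b : ℕ} {σ τ : Memory} (h : Agree b σ τ) (x : Cell) (v : WithBot ℝ) :
    Agree b σ (τ.set x v) := h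

/-! ### Counting loops and multiplication of indices -/

/-- Counting loop: register `r` runs through the numbers below the content of register `N`.
Register `1` has to hold the number `1`. -/
def Prog.for (r N : ℕ) (P : Prog) : Prog :=
  .seq (.regConst r 0) (.while (.regLt r N) (.seq P (.regAdd r r 1)))

/-- The arrays of a memory. -/
abbrev Arrays : Type := ℕ → ℕ → ℕ → WithBot ℝ

/-- The invariant speaks of arrays only; registers are handled by the convention that a loop over
register `r` leaves everything below `r` alone, so nested loops use increasing registers. Each
iteration has overhead `3` (test, unfolding, increment), and so has the loop itself (unfolding,
initialisation, final test). -/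
theorem Does.for {r N : ℕ} {P : Prog} {σ : Memory} {T : ℕ} {n : ℕ} (I : ℕ → Arrays → Prop)
    (h1 : σ.reg 1 = 1) (hr : 1 < r) (hN : N < r) (hn : σ.reg N = n) (h0 : I 0 σ.arr)
    (hP : ∀ i < n, ∀ τ, Agree r σ τ → τ.reg r = i → I i τ.arr →
      Does P τ T fun υ => Agree (r + 1) τ υ ∧ I (i + 1) υ.arr) :
    Does (.for r N P) σ (n * (T + 3) + 3) fun τ => Agree r σ τ ∧ I n τ.arr := by
  have key : ∀ k i, i + k = n → ∀ τ, Agree r σ τ → τ.reg r = i → I i τ.arr →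
      Does (.while (.regLt r N) (.seq P (.regAdd r r 1))) τ (k * (T + 3) + 1)
        fun τ => Agree r σ τ ∧ I n τ.arr := by
    intro k
    induction k with
    | zero =>
      intro i hi τ ha hτ hI
      refine (Does.while_of_not ?_ ⟨ha, ?_⟩).le (by omega)
      · simp only [Test.Holds, hτ, ha N hN, hn]; omega
      · rwa [← hi]
    | succ k ih =>
      intro i hi τ ha hτ hI
      refine (Does.while_of (T := T + 1 + 1) (T' := k * (T + 3) + 1) ?_ ?_).le (by ring_nf; omega)
      · simp only [Test.Holds, hτ, ha N hN, hn]; omega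
      · refine Does.seq ((hP i (by omega) τ ha hτ hI).mono le_rfl ?_)
        rintro υ ⟨hυ, hI'⟩
        refine Does.regAdd (ih (i + 1) (by omega) _ ?_ ?_ hI')
        · exact (ha.trans (hυ.anti (by omega))).setReg le_rfl _
        · simp [hυ r (by omega), hυ 1 (by omega), hτ, ha 1 hr, h1]
  refine (Does.seq (Does.regConst (key n 0 (by omega) _ ?_ ?_ h0))).le (by omega)
  · exact (Agree.refl r σ).setReg le_rfl _
  · simp

/-- A loop whose body establishes `R i`, where the loop also preserves `G` and the preorder `S`. -/
theorem Does.for_forall {r N : ℕ} {P : Prog} {σ : Memory} {T : ℕ} {n : ℕ} (G : Arrays → Prop)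
    (S : Arrays → Arrays → Prop) (R : ℕ → Arrays → Arrays → Prop)
    (hS : ∀ a, S a a) (hS' : ∀ a b c, S a b → S b c → S a c)
    (hl : ∀ i a b c, S a b → R i b c → R i a c) (hrr : ∀ i a b c, R i a b → S b c → R i a c)
    (h1 : σ.reg 1 = 1) (hr : 1 < r) (hN : N < r) (hn : σ.reg N = n) (h0 : G σ.arr)
    (hP : ∀ i < n, ∀ τ, Agree r σ τ → τ.reg r = i → G τ.arr →
      Does P τ T fun υ => Agree (r + 1) τ υ ∧ G υ.arr ∧ S τ.arr υ.arr ∧ R i τ.arr υ.arr) :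
    Does (.for r N P) σ (n * (T + 3) + 3) fun τ =>
      Agree r σ τ ∧ G τ.arr ∧ S σ.arr τ.arr ∧ ∀ i < n, R i σ.arr τ.arr := by
  refine Does.for (fun i a => G a ∧ S σ.arr a ∧ ∀ i' < i, R i' σ.arr a) h1 hr hN hn
    ⟨h0, hS _, by simp⟩ ?_
  rintro i hi τ ha hτ ⟨hG, hSτ, hR⟩
  refine (hP i hi τ ha hτ hG).mono le_rfl ?_
  rintro υ ⟨hυ, hG', hS1, hR1⟩
  refine ⟨hυ, hG', hS' _ _ _ hSτ hS1, fun i' hi' => ?_⟩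
  rcases Nat.lt_succ_iff_lt_or_eq.1 hi' with h | rfl
  · exact hrr _ _ _ _ (hR i' h) hS1
  · exact hl _ _ _ _ hSτ hR1

/-- A loop whose body raises the flag `F` if and only if `R i`, where the loop preserves `G`. -/
theorem Does.for_exists {r N : ℕ} {P : Prog} {σ : Memory} {T : ℕ} {n : ℕ} (G F : Arrays → Prop)
    (R : ℕ → Prop)
    (h1 : σ.reg 1 = 1) (hr : 1 < r) (hN : N < r) (hn : σ.reg N = n) (h0 : G σ.arr)
    (hP : ∀ i < n, ∀ τ, Agree r σ τ → τ.reg r = i → G τ.arr →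
      Does P τ T fun υ => Agree (r + 1) τ υ ∧ G υ.arr ∧ (F υ.arr ↔ F τ.arr ∨ R i)) :
    Does (.for r N P) σ (n * (T + 3) + 3) fun τ =>
      Agree r σ τ ∧ G τ.arr ∧ (F τ.arr ↔ F σ.arr ∨ ∃ i < n, R i) := by
  refine Does.for (fun i a => G a ∧ (F a ↔ F σ.arr ∨ ∃ i' < i, R i')) h1 hr hN hn
    ⟨h0, by simp⟩ ?_
  rintro i hi τ ha hτ ⟨hG, hF⟩
  refine (hP i hi τ ha hτ hG).mono le_rfl ?_
  rintro υ ⟨hυ, hG', hF'⟩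
  refine ⟨hυ, hG', ?_⟩
  rw [hF', hF, or_assoc]
  refine or_congr_right ⟨?_, ?_⟩
  · rintro (⟨k, hk, h⟩ | h)
    · exact ⟨k, by omega, h⟩
    · exact ⟨i, by omega, h⟩
  · rintro ⟨k, hk, h⟩
    rcases Nat.lt_succ_iff_lt_or_eq.1 hk with h' | rfl
    · exact Or.inl ⟨k, h', h⟩
    · exact Or.inr h

/-- Multiplication of index registers by repeated addition, with `c` as a counter. -/
def Prog.mul (d s t c : ℕ) : Prog :=
  .seq (.regConst d 0) (.seq (.regConst c 0)
    (.while (.regLt c t) (.seq (.regAdd d d s) (.regAdd c c 1))))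

/-- The inequations exclude harmful aliasing of registers. The cost is linear in the second factor,
so callers put a number of size `n` there. -/
theorem Does.mul {d s t c : ℕ} {σ : Memory} {Q : Memory → Prop} (h1 : σ.reg 1 = 1)
    (hd1 : d ≠ 1) (hc1 : c ≠ 1) (hdc : d ≠ c) (hsd : s ≠ d) (hsc : s ≠ c) (htd : t ≠ d)
    (htc : t ≠ c) {n : ℕ} (hn : σ.reg t = n)
    (h : Q ((σ.setReg d (σ.reg s * n)).setReg c n)) :
    Does (.mul d s t c) σ (n * 4 + 5) Q := by
  have key : ∀ k i, i + k = n →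
      Does (.while (.regLt c t) (.seq (.regAdd d d s) (.regAdd c c 1)))
        ((σ.setReg d (σ.reg s * i)).setReg c i) (k * 4 + 1) Q := by
    intro k
    induction k with
    | zero =>
      rintro i rfl
      refine (Does.while_of_not ?_ h).le (by omega)
      simp [Test.Holds, Memory.setReg_reg_of_ne, htc, htd, hn]
    | succ k ih =>
      intro i hi
      refine (Does.while_of (T := 1 + 1 + 1) (T' := k * 4 + 1) ?_ ?_).le (by omega)
      · simp only [Test.Holds, Memory.setReg_reg_self, Memory.setReg_reg_of_ne _ _ htc,
          Memory.setReg_reg_of_ne _ _ htd, hn]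
        omega
      · refine Does.seq (Does.regAdd (Does.regAdd ?_))
        convert ih (i + 1) (by omega) using 1
        simp only [Memory.setReg, Memory.mk.injEq, and_true]
        funext r
        simp only [Function.update_apply]
        split_ifs <;> simp_all [mul_add]
  refine (Does.seq (Does.regConst (Does.seq (Does.regConst ?_)))).le
    (T := 1 + (1 + (n * 4 + 1) + 1) + 1) (by omega)
  simpa using key n 0 (by omega)

/-! ### Growth of numbers during a run -/

/-- The largest number in a `regConst` command of a program. -/
def Prog.maxConst : Prog → ℕ
  | .regConst _ k => k
  | .seq P Q => max P.maxConst Q.maxConst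
  | .ite _ P Q => max P.maxConst Q.maxConst
  | .while _ P => P.maxConst
  | _ => 0

/-- `x` is `-∞` or a fraction with denominator `D` and numerator at most `A` in absolute value. -/
def IsFraction (D A : ℕ) (x : WithBot ℝ) : Prop :=
  x = ⊥ ∨ ∃ a : ℤ, a.natAbs ≤ A ∧ x = ((a / D : ℝ) : WithBot ℝ)

theorem IsFraction.mono {D A B : ℕ} {x : WithBot ℝ} (h : IsFraction D A x) (hAB : A ≤ B) :
    IsFraction D B x := by
  rcases h with h | ⟨a, ha, h⟩
  · exact Or.inl h
  · exact Or.inr ⟨a, ha.trans hAB, h⟩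

theorem IsFraction.zero (D A : ℕ) : IsFraction D A 0 := Or.inr ⟨0, by simp, by simp⟩

/-- Over a fixed denominator the numerators simply add; the denominator never grows. -/
theorem IsFraction.add {D A B : ℕ} {x y : WithBot ℝ} (hx : IsFraction D A x)
    (hy : IsFraction D B y) : IsFraction D (A + B) (x + y) := by
  rcases hx with rfl | ⟨a, ha, rfl⟩
  · exact Or.inl (by simp)
  rcases hy with rfl | ⟨b, hb, rfl⟩
  · exact Or.inl (by simp)
  refine Or.inr ⟨a + b, (Int.natAbs_add_le a b).trans (add_le_add ha hb), ?_⟩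
  rw [← WithBot.coe_add]
  push_cast
  rw [add_div]
  rfl

/-- Bounds for all constants, index registers and cells of a configuration. -/
structure Bounded (D c B A : ℕ) (κ : Config) : Prop where
  code : ∀ P ∈ κ.code, P.maxConst ≤ c
  reg : ∀ r, κ.mem.reg r ≤ B
  arr : ∀ a i j, IsFraction D A (κ.mem.arr a i j)

theorem Bounded.mono {D c B A B' A' : ℕ} {κ : Config} (h : Bounded D c B A κ) (hB : B ≤ B')
    (hA : A ≤ A') : Bounded D c B' A' κ :=
  ⟨h.code, fun r => (h.reg r).trans hB, fun a i j => (h.arr a i j).mono hA⟩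

theorem Bounded.set {D c B A : ℕ} {P : Prog} {l : List Prog} {σ : Memory}
    (h : Bounded D c B A ⟨P :: l, σ⟩) (x : Cell) {v : WithBot ℝ} (hv : IsFraction D A v) :
    Bounded D c B A ⟨l, σ.set x v⟩ := by
  refine ⟨fun Q hQ => h.code Q (List.mem_cons_of_mem _ hQ), h.reg, fun a i j => ?_⟩
  simp only [Memory.set]
  split_ifs
  · exact hv
  · exact h.arr a i j

theorem Bounded.setReg {D c B A : ℕ} {P : Prog} {l : List Prog} {σ : Memory}
    (h : Bounded D c B A ⟨P :: l, σ⟩) (r : ℕ) {k : ℕ} (hk : k ≤ B) :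
    Bounded D c B A ⟨l, σ.setReg r k⟩ := by
  refine ⟨fun Q hQ => h.code Q (List.mem_cons_of_mem _ hQ), fun s => ?_, h.arr⟩
  simp only [Memory.setReg, Function.update_apply]
  split_ifs
  · exact hk
  · exact h.reg s

/-- Addition is the only operation that can exceed the present bounds, and it at most doubles them;
`hc` takes care of loaded constants, and the code only ever decomposes into subprograms. -/
theorem Bounded.step {D c B A : ℕ} {κ : Config} (h : Bounded D c B A κ) (hc : c ≤ B) :
    Bounded D c (2 * B) (2 * A) (step κ) := by
  have h' := h.mono (B' := 2 * B) (A' := 2 * A) (by omega) (by omega)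
  obtain ⟨code, σ⟩ := κ
  rcases code with _ | ⟨P, l⟩
  · exact h'
  have hc2 : ∀ Q ∈ l, Q.maxConst ≤ c := fun Q hQ => h.code Q (List.mem_cons_of_mem _ hQ)
  have hP := h.code P List.mem_cons_self
  cases P with
  | skip => exact ⟨hc2, h'.reg, h'.arr⟩
  | regConst r k =>
    simp only [Prog.maxConst] at hP
    exact h'.setReg r (by omega)
  | regAdd r s t =>
    have h1 := h.reg s
    have h2 := h.reg t
    exact h'.setReg r (by simp only at h1 h2; omega)
  | regSub r s t =>
    have h1 := h.reg s
    exact h'.setReg r (by simp only at h1; omega)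
  | cellZero x => exact h'.set x (IsFraction.zero _ _)
  | cellBot x => exact h'.set x (Or.inl rfl)
  | cellCopy x y => exact h'.set x (h'.arr _ _ _)
  | cellAdd x y z =>
    refine h'.set x ?_
    rw [two_mul]
    exact (h.arr _ _ _).add (h.arr _ _ _)
  | seq P Q =>
    simp only [Prog.maxConst, max_le_iff] at hP
    refine ⟨?_, h'.reg, h'.arr⟩
    simp only [ArithRAM.step, List.mem_cons]
    rintro R (rfl | rfl | hR)
    exacts [hP.1, hP.2, hc2 R hR]
  | ite b P Q =>
    simp only [Prog.maxConst, max_le_iff] at hP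
    simp only [ArithRAM.step]
    split_ifs
    · refine ⟨?_, h'.reg, h'.arr⟩
      simp only [List.mem_cons]
      rintro R (rfl | hR)
      exacts [hP.1, hc2 R hR]
    · refine ⟨?_, h'.reg, h'.arr⟩
      simp only [List.mem_cons]
      rintro R (rfl | hR)
      exacts [hP.2, hc2 R hR]
  | _ =>
    rename_i b P
    simp only [ArithRAM.step]
    split_ifs
    · refine ⟨?_, h'.reg, h'.arr⟩
      simp only [List.mem_cons]
      rintro R (rfl | rfl | hR)
      exacts [hP, hP, hc2 R hR]
    · exact ⟨hc2, h'.reg, h'.arr⟩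

theorem Bounded.iterate_step {D c B A : ℕ} {κ : Config} (h : Bounded D c B A κ) (hc : c ≤ B)
    (t : ℕ) : Bounded D c (2 ^ t * B) (2 ^ t * A) (ArithRAM.step^[t] κ) := by
  induction t with
  | zero => simpa using h
  | succ t ih =>
    rw [Function.iterate_succ_apply', pow_succ', mul_assoc, mul_assoc]
    exact ih.step (hc.trans (Nat.le_mul_of_pos_left _ (by positivity)))

theorem step_of_code_eq_nil {κ : Config} (h : κ.code = []) : step κ = κ := by
  obtain ⟨code, σ⟩ := κ
  subst h
  rfl

theorem iterate_step_of_code_eq_nil {κ : Config} {t s : ℕ} (h : (step^[t] κ).code = [])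
    (hts : t ≤ s) : step^[s] κ = step^[t] κ := by
  obtain ⟨k, rfl⟩ := Nat.exists_eq_add_of_le' hts
  rw [Function.iterate_add_apply]
  exact Function.iterate_fixed (step_of_code_eq_nil h) k

/-! ### Common denominators and encoding lengths -/

/-- The denominator of an element of `ℚ ∪ {-∞}`; that of `-∞` is `1`. -/
def botDen : WithBot ℚ → ℕ
  | ⊥ => 1
  | (q : ℚ) => q.den

theorem botDen_le (x : WithBot ℚ) : botDen x ≤ 2 ^ encodingLength x := by
  induction x with
  | bot => simp [botDen, encodingLength]
  | coe q =>
    have h : q.den < 2 ^ q.den.size := Nat.size_le.1 le_rfl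
    exact h.le.trans (Nat.pow_le_pow_right (by norm_num) (by simp only [encodingLength]; omega))

theorem botDen_pos (x : WithBot ℚ) : 0 < botDen x := by
  induction x with
  | bot => simp [botDen]
  | coe q => exact q.den_pos

theorem isFraction_of_dvd {x : WithBot ℚ} {D N : ℕ} (hD : 0 < D) (hDN : D ≤ 2 ^ N)
    (hx : botDen x ∣ D) (hl : encodingLength x ≤ N) :
    IsFraction D (2 ^ (2 * N)) (ratToRmax x) := by
  induction x with
  | bot => exact Or.inl rfl
  | coe q =>
    obtain ⟨e, rfl⟩ := hx
    right
    simp only [botDen, encodingLength] at *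
    -- Expanding to the denominator `D` multiplies the numerator by the cofactor `e ≤ D`; both
    -- factors are at most `2 ^ N`.
    refine ⟨q.num * e, ?_, ?_⟩
    · rw [Int.natAbs_mul, Int.natAbs_natCast, two_mul, pow_add]
      have h : q.num.natAbs < 2 ^ q.num.natAbs.size := Nat.size_le.1 le_rfl
      refine Nat.mul_le_mul (h.le.trans (Nat.pow_le_pow_right (by norm_num) (by omega))) ?_
      exact (Nat.le_mul_of_pos_left e q.den_pos).trans hDN
    · simp only [ratToRmax, WithBot.map_coe, WithBot.coe_inj]
      have he : (e : ℝ) ≠ 0 := by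
        rintro h
        simp only [Nat.cast_eq_zero] at h
        simp [h] at hD
      have hq : (q.den : ℝ) ≠ 0 := by exact_mod_cast q.den_ne_zero
      conv_lhs => rw [← Rat.num_div_den q]
      push_cast
      field_simp

/-- Cancelling only helps: the reduced numerator divides the given one, and the reduced denominator
divides `D`. -/
theorem IsFraction.exists_rat {D A a : ℕ} {x : WithBot ℝ} (h : IsFraction D (2 ^ A) x)
    (hD : 0 < D) (hDN : D ≤ 2 ^ a) :
    ∃ q : WithBot ℚ, x = ratToRmax q ∧ encodingLength q ≤ A + a + 3 := by
  rcases h with rfl | ⟨z, hz, rfl⟩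
  · exact ⟨⊥, rfl, by simp only [encodingLength]; omega⟩
  refine ⟨((z / D : ℚ) : WithBot ℚ), ?_, ?_⟩
  · simp [ratToRmax]
  · have h2 : ((z / D : ℚ)).num.natAbs ≤ 2 ^ A := by
      rcases eq_or_ne z 0 with rfl | h0
      · simp
      refine (Nat.le_of_dvd (Int.natAbs_pos.2 h0) ?_).trans hz
      rw [Int.natAbs_dvd_natAbs]
      have := Rat.num_dvd z (b := (D : ℤ)) (by omega)
      rwa [Rat.divInt_eq_div] at this
    have h3 : ((z / D : ℚ)).den ≤ 2 ^ a := by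
      refine (Nat.le_of_dvd hD ?_).trans hDN
      have := Rat.den_dvd z (D : ℤ)
      rw [Rat.divInt_eq_div] at this
      exact_mod_cast this
    have h4 : ((z / D : ℚ)).num.natAbs.size ≤ A + 1 :=
      Nat.size_le.2 (h2.trans_lt (Nat.pow_lt_pow_right (by norm_num) (by omega)))
    have h5 : ((z / D : ℚ)).den.size ≤ a + 1 :=
      Nat.size_le.2 (h3.trans_lt (Nat.pow_lt_pow_right (by norm_num) (by omega)))
    simp only [encodingLength]
    omega

theorem one_le_encodingLength (x : WithBot ℚ) : 1 ≤ encodingLength x := by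
  induction x with
  | bot => simp [encodingLength]
  | coe q => simp only [encodingLength]; omega

section Instance

variable {n : ℕ} (L C R : Matrix (Fin n) (Fin n) (WithBot ℚ))

/-- A common denominator of all entries of an instance. -/
def commonDen : ℕ := ∏ i, ∏ j, (botDen (L i j) * botDen (C i j) * botDen (R i j))

theorem commonDen_pos : 0 < commonDen L C R :=
  Finset.prod_pos fun _ _ => Finset.prod_pos fun _ _ =>
    mul_pos (mul_pos (botDen_pos _) (botDen_pos _)) (botDen_pos _)

theorem commonDen_le : commonDen L C R ≤ 2 ^ instanceLength L C R := by
  rw [commonDen, instanceLength, ← Finset.prod_pow_eq_pow_sum]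
  refine Finset.prod_le_prod' fun i _ => ?_
  rw [← Finset.prod_pow_eq_pow_sum]
  refine Finset.prod_le_prod' fun j _ => ?_
  rw [pow_add, pow_add]
  exact Nat.mul_le_mul (Nat.mul_le_mul (botDen_le _) (botDen_le _)) (botDen_le _)

theorem mul_dvd_commonDen (i j : Fin n) :
    botDen (L i j) * botDen (C i j) * botDen (R i j) ∣ commonDen L C R :=
  (Finset.dvd_prod_of_mem (fun j => botDen (L i j) * botDen (C i j) * botDen (R i j))
    (Finset.mem_univ j)).trans (Finset.dvd_prod_of_mem
      (fun i => ∏ j, (botDen (L i j) * botDen (C i j) * botDen (R i j))) (Finset.mem_univ i))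

theorem add_le_instanceLength (i j : Fin n) :
    encodingLength (L i j) + encodingLength (C i j) + encodingLength (R i j)
      ≤ instanceLength L C R :=
  (Finset.single_le_sum (f := fun j => encodingLength (L i j) + encodingLength (C i j) +
    encodingLength (R i j)) (fun _ _ => Nat.zero_le _) (Finset.mem_univ j)).trans
    (Finset.single_le_sum (f := fun i => ∑ j, (encodingLength (L i j) + encodingLength (C i j) +
      encodingLength (R i j))) (fun _ _ => Nat.zero_le _) (Finset.mem_univ i))

theorem le_instanceLength : n ≤ instanceLength L C R := by
  have h : ∀ i : Fin n, 1 ≤ ∑ j, (encodingLength (L i j) + encodingLength (C i j) +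
      encodingLength (R i j)) := by
    intro i
    refine le_trans ?_ (Finset.single_le_sum (f := fun j => encodingLength (L i j) +
      encodingLength (C i j) + encodingLength (R i j)) (fun _ _ => Nat.zero_le _)
      (Finset.mem_univ i))
    have := one_le_encodingLength (L i i)
    omega
  simpa [instanceLength] using Finset.sum_le_sum fun i (_ : i ∈ Finset.univ) => h i

theorem isFraction_initMemory (a i j : ℕ) :
    IsFraction (commonDen L C R) (2 ^ (2 * instanceLength L C R))
      ((initMemory (L.map ratToRmax) (C.map ratToRmax) (R.map ratToRmax)).arr a i j) := by
  simp only [initMemory, Matrix.map_apply]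
  have hD := mul_dvd_commonDen L C R
  have hN := add_le_instanceLength L C R
  split_ifs with h
  · exact isFraction_of_dvd (commonDen_pos L C R) (commonDen_le L C R)
      (((Dvd.intro _ rfl).trans (Dvd.intro _ rfl)).trans (hD ⟨i, h.1⟩ ⟨j, h.2⟩))
      (by have := hN ⟨i, h.1⟩ ⟨j, h.2⟩; omega)
  · exact isFraction_of_dvd (commonDen_pos L C R) (commonDen_le L C R)
      (((Dvd.intro_left _ rfl).trans (Dvd.intro _ rfl)).trans (hD ⟨i, h.1⟩ ⟨j, h.2⟩))
      (by have := hN ⟨i, h.1⟩ ⟨j, h.2⟩; omega)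
  · exact isFraction_of_dvd (commonDen_pos L C R) (commonDen_le L C R)
      ((Dvd.intro_left _ rfl).trans (hD ⟨i, h.1⟩ ⟨j, h.2⟩))
      (by have := hN ⟨i, h.1⟩ ⟨j, h.2⟩; omega)
  · exact Or.inl rfl
  · exact Or.inl rfl

end Instance

/-- A program that decides a problem in polynomial time only produces numbers of polynomial
length, since one step at most doubles all numbers over a common denominator. -/
theorem DecidesWithin.hasPolynomialNumbers {P : Prog}
    {Q : ∀ n : ℕ, RmaxMatrix n → RmaxMatrix n → RmaxMatrix n → Prop} {K d : ℕ}
    (h : DecidesWithin P Q fun n => K * n ^ d) : HasPolynomialNumbers P := by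
  -- After `s ≤ K N^d` steps, numerators are at most `2^(s + 2N)` and the denominator at most `2^N`,
  -- while registers stay below `2^(s + n + maxConst)` with `n ≤ N`.
  refine ⟨.C K * .X ^ d + .C 4 * .X + .C (P.maxConst + 4), fun n hn L C R t => ?_⟩
  set N := instanceLength L C R with hN
  set κ : Config := ⟨[P], initMemory (L.map ratToRmax) (C.map ratToRmax) (R.map ratToRmax)⟩ with hκ
  have heval : (Polynomial.C K * Polynomial.X ^ d + Polynomial.C 4 * Polynomial.X +
      Polynomial.C (P.maxConst + 4) : Polynomial ℕ).eval N = K * N ^ d + 4 * N + (P.maxConst + 4) :=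
    by simp
  have hnN : n ≤ N := le_instanceLength L C R
  -- A halted configuration no longer changes, so an arbitrary time can be replaced by one within
  -- the time bound.
  obtain ⟨s, hs, hrun⟩ : ∃ s ≤ K * N ^ d,
      run P (L.map ratToRmax) (C.map ratToRmax) (R.map ratToRmax) t = step^[s] κ := by
    obtain ⟨t0, ht0, hcode, -⟩ := h n hn (L.map ratToRmax) (C.map ratToRmax) (R.map ratToRmax)
    have ht0' : t0 ≤ K * N ^ d := ht0.trans (Nat.mul_le_mul_left _ (Nat.pow_le_pow_left hnN d))
    rcases le_total t0 t with h | h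
    · exact ⟨t0, ht0', iterate_step_of_code_eq_nil hcode h⟩
    · exact ⟨t, h.trans ht0', rfl⟩
  rw [hrun, heval]
  have hb : Bounded (commonDen L C R) P.maxConst (n + P.maxConst) (2 ^ (2 * N)) κ := by
    refine ⟨by simp [hκ], fun r => ?_, isFraction_initMemory L C R⟩
    simp only [hκ, initMemory]
    split_ifs <;> omega
  have hb' := hb.iterate_step (by omega) s
  refine ⟨fun r => ?_, fun a i j => ?_⟩
  · have h1 : (step^[s] κ).mem.reg r < 2 ^ (s + (n + P.maxConst)) := by
      refine (hb'.reg r).trans_lt ?_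
      rw [pow_add]
      exact Nat.mul_lt_mul_of_pos_left Nat.lt_two_pow_self (by positivity)
    have := Nat.size_le.2 h1
    omega
  · have h1 := hb'.arr a i j
    rw [← pow_add] at h1
    obtain ⟨q, hq, hl⟩ := h1.exists_rat (commonDen_pos L C R) (commonDen_le L C R)
    exact ⟨q, hq, by omega⟩

end ArithRAM

/-! ## Walks with labels in a group -/

/-- Walks of a given length in a graph whose arcs `E i a j` carry labels `a`; a walk is labelled by
the sum of the labels of its arcs. -/
inductive LWalk {V A : Type*} [AddCommGroup A] (E : V → A → V → Prop) : ℕ → V → A → V → Prop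
  | nil (i : V) : LWalk E 0 i 0 i
  | snoc {l : ℕ} {i k j : V} {a b : A} (p : LWalk E l i a k) (h : E k b j) :
      LWalk E (l + 1) i (a + b) j

namespace LWalk

variable {V A : Type*} [AddCommGroup A] {E : V → A → V → Prop}

theorem trans {l m : ℕ} {i j k : V} {a b : A} (p : LWalk E l i a j) (q : LWalk E m j b k) :
    LWalk E (l + m) i (a + b) k := by
  induction q with
  | nil => simpa using p
  | snoc q h ih => rw [← add_assoc, ← add_assoc]; exact (ih p).snoc h

theorem label_eq_zero {i j : V} {a : A} (p : LWalk E 0 i a j) : a = 0 := by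
  cases p; rfl

/-- A walk as a sequence of nodes `f` with partial sums `g`, the form in which it can be cut at
arbitrary times by `of_seq`. -/
theorem exists_seq {l : ℕ} {i j : V} {a : A} (p : LWalk E l i a j) :
    ∃ (f : ℕ → V) (g : ℕ → A), f 0 = i ∧ g 0 = 0 ∧ f l = j ∧ g l = a ∧
      ∀ t < l, E (f t) (g (t + 1) - g t) (f (t + 1)) := by
  induction p with
  | nil i => exact ⟨fun _ => i, fun _ => 0, rfl, rfl, rfl, rfl, by simp⟩
  | @snoc l i k j a b p h ih =>
    obtain ⟨f, g, hf0, hg0, hfl, hgl, hE⟩ := ih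
    refine ⟨fun t => if t ≤ l then f t else j, fun t => if t ≤ l then g t else a + b,
      by simpa using hf0, by simpa using hg0, by simp, by simp, fun t ht => ?_⟩
    rcases Nat.lt_succ_iff_lt_or_eq.1 ht with h' | rfl
    · simpa [h'.le, Nat.succ_le_of_lt h'] using hE t h'
    · simpa [hfl, hgl] using h

theorem of_seq {l : ℕ} {f : ℕ → V} {g : ℕ → A}
    (hE : ∀ t < l, E (f t) (g (t + 1) - g t) (f (t + 1))) (t m : ℕ) (h : t + m ≤ l) :
    LWalk E m (f t) (g (t + m) - g t) (f (t + m)) := by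
  induction m with
  | zero => simpa using LWalk.nil (f t)
  | succ m ih =>
    have := (ih (by omega)).snoc (hE (t + m) (by omega))
    rwa [sub_add_sub_comm, add_comm (g (t + m)), add_sub_add_right_eq_sub] at this

/-- A walk of length at least the number of nodes contains a short closed walk. -/
theorem exists_closed [Fintype V] {l : ℕ} {i j : V} {a : A} (p : LWalk E l i a j)
    (hl : Fintype.card V ≤ l) :
    ∃ (m c : ℕ) (k : V) (a' b : A), 1 ≤ c ∧ c ≤ Fintype.card V ∧ LWalk E m i a' j ∧
      LWalk E c k b k ∧ a = a' + b ∧ l = m + c := by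
  obtain ⟨f, g, rfl, hg0, rfl, rfl, hE⟩ := p.exists_seq
  -- Pigeonhole on the first `card V + 1` nodes only, which also bounds the length of the closed
  -- walk.
  obtain ⟨t, u, htu, hu, hfe⟩ : ∃ t u, t < u ∧ u ≤ Fintype.card V ∧ f t = f u := by
    obtain ⟨x, y, hxy, hf⟩ := Fintype.exists_ne_map_eq_of_card_lt
      (fun t : Fin (Fintype.card V + 1) => f t) (by simp)
    rcases lt_or_gt_of_ne (fun h => hxy (Fin.ext h) : (x : ℕ) ≠ y) with h | h
    · exact ⟨x, y, h, by omega, hf⟩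
    · exact ⟨y, x, h, by omega, hf.symm⟩
  have h1 := of_seq hE 0 t (by omega)
  have h2 := of_seq hE t (u - t) (by omega)
  have h3 := of_seq hE u (l - u) (by omega)
  rw [show t + (u - t) = u by omega] at h2
  rw [show u + (l - u) = l by omega] at h3
  rw [Nat.zero_add] at h1
  rw [← hfe] at h2 h3
  exact ⟨_, _, _, _, _, by omega, by omega, h1.trans h3, h2, by rw [hg0]; abel, by omega⟩

/-- Short closed walks can be removed from a walk until its length is less than the number of
nodes. -/
theorem exists_short [Fintype V] {P : A → Prop} (h0 : P 0) (hadd : ∀ a b, P a → P b → P (a + b))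
    (hP : ∀ c ≤ Fintype.card V, ∀ k b, LWalk E c k b k → P b) {l : ℕ} {i j : V} {a : A}
    (p : LWalk E l i a j) :
    ∃ m < Fintype.card V, ∃ a', LWalk E m i a' j ∧ P (a - a') := by
  induction l using Nat.strong_induction_on generalizing a with
  | _ l ih =>
    rcases lt_or_ge l (Fintype.card V) with hl | hl
    · exact ⟨l, hl, a, p, by simpa using h0⟩
    · obtain ⟨m, c, k, a', b, hc1, hc, p', q, rfl, rfl⟩ := p.exists_closed hl
      obtain ⟨m', hm', a'', p'', h⟩ := ih m (by omega) p'
      refine ⟨m', hm', a'', p'', ?_⟩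
      rw [add_sub_right_comm]
      exact hadd _ _ h (hP c hc k b q)

theorem le_mul {E : V → ℝ → V → Prop} {M : ℝ} (hM : ∀ i a j, E i a j → a ≤ M) {l : ℕ} {i j : V}
    {a : ℝ} (p : LWalk E l i a j) : a ≤ l * M := by
  induction p with
  | nil => simp
  | snoc p h ih => have := hM _ _ _ h; push_cast; linarith

/-- If no short closed walk has positive weight, then the weights are bounded by the differences of
a potential. -/
theorem exists_potential [Fintype V] {E : V → ℝ → V → Prop} {M : ℝ}
    (hM : ∀ i a j, E i a j → a ≤ M)
    (hE : ∀ c ≤ Fintype.card V, ∀ k b, LWalk E c k b k → b ≤ 0) :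
    ∃ h : V → ℝ, ∀ i a j, E i a j → a ≤ h j - h i := by
  have hbdd : ∀ j, BddAbove {a | ∃ l i, LWalk E l i a j} := by
    refine fun j => ⟨Fintype.card V * max M 0, ?_⟩
    rintro a ⟨l, i, p⟩
    -- The removed closed walks have nonpositive weight, so shortening does not lower the weight,
    -- and short walks have bounded weight.
    obtain ⟨m, hm, a', p', h⟩ := p.exists_short (P := fun a : ℝ => a ≤ (0 : ℝ)) le_rfl
      (fun a b ha hb => add_nonpos ha hb) hE
    have h1 := p'.le_mul (M := max M 0) fun i a j h => (hM i a j h).trans (le_max_left _ _)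
    have h2 : (m : ℝ) * max M 0 ≤ Fintype.card V * max M 0 :=
      mul_le_mul_of_nonneg_right (by exact_mod_cast hm.le) (le_max_right _ _)
    linarith
  -- The potential of `j` is the greatest weight of a walk ending in `j`, from any start; the empty
  -- walk keeps the set nonempty.
  refine ⟨fun j => sSup {a | ∃ l i, LWalk E l i a j}, fun i a j h => ?_⟩
  rw [le_sub_iff_add_le', ← le_sub_iff_add_le]
  refine csSup_le ⟨0, 0, i, .nil i⟩ ?_
  rintro b ⟨l, k, p⟩
  rw [le_sub_iff_add_le]
  exact le_csSup (hbdd j) ⟨l + 1, k, p.snoc h⟩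

theorem natAbs_fst_le {E : V → ℤ × ℝ → V → Prop} (hs : ∀ i a j, E i a j → a.1.natAbs ≤ 1) {l : ℕ}
    {i j : V} {a : ℤ × ℝ} (p : LWalk E l i a j) : a.1.natAbs ≤ l := by
  induction p with
  | nil => simp
  | snoc p h ih => have := hs _ _ _ h; simp only [Prod.fst_add]; omega

theorem snd_le {E : V → ℤ × ℝ → V → Prop} {M : ℝ} (hM : ∀ i a j, E i a j → a.2 ≤ M) {l : ℕ}
    {i j : V} {a : ℤ × ℝ} (p : LWalk E l i a j) : a.2 ≤ l * M := by
  induction p with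
  | nil => simp
  | snoc p h ih => have := hM _ _ _ h; push_cast; simp only [Prod.snd_add]; linarith

end LWalk

/-! ## Periodic potentials -/

section Potential

variable {V : Type*} {E : V → ℤ × ℝ → V → Prop}

/-- Slopes `lam` that increase along all arcs and turn all short closed walks into walks of
nonpositive weight. -/
theorem exists_slope (N : ℕ) {M : ℝ} (hM0 : 0 ≤ M) (hM : ∀ i a j, E i a j → a.2 ≤ M)
    (hZ : ∀ l ≤ N, ∀ i w, LWalk E l i (0, w) i → w ≤ 0)
    (hP : ∀ i j l a, LWalk E l i a j → ∀ l₁ ≤ N, ∀ l₂ ≤ N, ∀ s₁ s₂ : ℤ, 0 < s₁ → 0 < s₂ →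
      ∀ w₁ w₂ : ℝ, LWalk E l₁ i (s₁, w₁) i → LWalk E l₂ j (-s₂, w₂) j → s₂ * w₁ + s₁ * w₂ ≤ 0) :
    ∃ lam : V → ℝ, (∀ i a j, E i a j → lam i ≤ lam j) ∧
      ∀ l ≤ N, ∀ i (a : ℤ × ℝ), LWalk E l i a i → a.2 ≤ lam i * a.1 := by
  -- The slope at `i` is the best gain per level among short ascending closed walks upstream of `i`.
  -- The set of these rates only grows along arcs, whence monotonicity. The floor `-(N * M)` keeps
  -- it nonempty and lies below the loss rate of every short descending closed walk.
  set U : V → Set ℝ := fun i => {x | x = -(N * M) ∨ ∃ i' l a, LWalk E l i' a i ∧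
    ∃ l₁ ≤ N, ∃ (s : ℤ) (w : ℝ), 0 < s ∧ LWalk E l₁ i' (s, w) i' ∧ x = w / s} with hU
  have hne : ∀ i, (U i).Nonempty := fun i => ⟨_, Or.inl rfl⟩
  have hNM : 0 ≤ N * M := by positivity
  have hle : ∀ {l i a}, l ≤ N → LWalk E l i a i → a.2 ≤ N * M := fun hl p =>
    (p.snd_le hM).trans (mul_le_mul_of_nonneg_right (by exact_mod_cast hl) hM0)
  have hbdd : ∀ i, BddAbove (U i) := by
    refine fun i => ⟨N * M, ?_⟩
    rintro x (rfl | ⟨i', l, a, -, l₁, hl₁, s, w, hs, p, rfl⟩)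
    · linarith
    · have hs' : (1 : ℝ) ≤ s := by exact_mod_cast hs
      rw [div_le_iff₀ (by linarith)]
      have := hle hl₁ p
      simp only at this
      nlinarith
  refine ⟨fun i => sSup (U i), fun i a j h => ?_, fun l hl i a p => ?_⟩
  · refine csSup_le_csSup (hbdd j) (hne i) ?_
    rintro x (h' | ⟨i', l, b, q, h'⟩)
    · exact Or.inl h'
    · exact Or.inr ⟨i', l + 1, _, q.snoc h, h'⟩
  · obtain ⟨s, w⟩ := a
    rcases lt_trichotomy s 0 with hs | rfl | hs
    · have hs' : (s : ℝ) ≤ -1 := by exact_mod_cast (by omega : s ≤ -1)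
      have hw := hle hl p
      simp only at hw ⊢
      -- Here `s < 0`, so `w / s` is the loss per level of a descending closed walk; `hP` says that
      -- it is at least every gain rate upstream.
      have h1 : sSup (U i) ≤ w / s := by
        refine csSup_le (hne i) ?_
        rintro x (rfl | ⟨i', l', b, q, l₁, hl₁, s', w', hs1, p', rfl⟩)
        · rw [le_div_iff_of_neg (by linarith)]
          nlinarith
        · have := hP _ _ _ _ q l₁ hl₁ l hl s' (-s) hs1 (by omega) w' w p' (by simpa using p)
          have hs2 : (0 : ℝ) < s' := by exact_mod_cast hs1
          rw [div_le_iff₀ hs2, div_mul_eq_mul_div, le_div_iff_of_neg (by linarith)]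
          push_cast at this
          linarith
      rwa [le_div_iff_of_neg (by linarith)] at h1
    · simpa using hZ l hl i w p
    · have hs' : (0 : ℝ) < s := by exact_mod_cast hs
      rw [← div_le_iff₀ hs']
      exact le_csSup (hbdd i) (Or.inr ⟨i, 0, 0, .nil i, l, hl, s, w, hs, p, rfl⟩)

/-- A potential that increases with slope `lam i` on the copies of the node `i`. -/
theorem exists_periodic_potential [Fintype V] {M : ℝ} (hM : ∀ i a j, E i a j → a.2 ≤ M)
    (hs : ∀ i a j, E i a j → a.1.natAbs ≤ 1) {lam : V → ℝ}
    (hmono : ∀ i a j, E i a j → lam i ≤ lam j)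
    (hlam : ∀ l ≤ Fintype.card V, ∀ i (a : ℤ × ℝ), LWalk E l i a i → a.2 ≤ lam i * a.1) :
    ∃ h : V → ℝ, ∀ i (a : ℤ × ℝ) j, E i a j →
      a.2 ≤ lam j * a.1 + (lam j - lam i) + (h j - h i) := by
  -- Arc weights reduced by the increase of `lam i * k` from level `k = 1`, the level at which this
  -- increase is smallest.
  set E' : V → ℝ → V → Prop := fun i x j =>
    ∃ a : ℤ × ℝ, E i a j ∧ x = a.2 - lam j * a.1 - (lam j - lam i) with hE'
  have hwalk_mono : ∀ {l i x j}, LWalk E' l i x j → lam i ≤ lam j := by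
    intro l i x j p
    induction p with
    | nil => exact le_rfl
    | snoc p h ih => obtain ⟨a, h, -⟩ := h; exact ih.trans (hmono _ _ _ h)
  -- By monotonicity `lam` is constant along such a walk, in particular along a closed one, so the
  -- reduction telescopes to `lam i` times the shift.
  have hlift : ∀ {l i x j}, LWalk E' l i x j → lam j ≤ lam i →
      ∃ a : ℤ × ℝ, LWalk E l i a j ∧ x = a.2 - lam i * a.1 := by
    intro l i x j p
    induction p with
    | nil i => exact fun _ => ⟨0, .nil i, by simp⟩
    | snoc p h ih =>
      intro hji
      obtain ⟨b, h, rfl⟩ := h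
      have h1 := hwalk_mono p
      have h2 := hmono _ _ _ h
      obtain ⟨a, q, rfl⟩ := ih (h2.trans hji)
      refine ⟨a + b, q.snoc h, ?_⟩
      rw [le_antisymm (h2.trans hji) h1] at *
      rw [le_antisymm hji h2]
      push_cast [Prod.fst_add, Prod.snd_add]
      ring
  obtain ⟨B, hB⟩ : ∃ B, ∀ i, |lam i| ≤ B := by
    obtain ⟨B, hB⟩ := (Set.finite_range fun i => |lam i|).bddAbove
    exact ⟨B, fun i => hB ⟨i, rfl⟩⟩
  -- The shift is at most `1` in absolute value, so `lam j * a.1` costs at most `B` and `lam j - lam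
  -- i` at most `2 * B`.
  obtain ⟨h, hh⟩ := LWalk.exists_potential (E := E') (M := M + 3 * B) (by
      rintro i x j ⟨a, ha, rfl⟩
      have h1 := hM _ _ _ ha
      have h2 : |(a.1 : ℝ)| ≤ 1 := by
        have := hs _ _ _ ha
        rw [← Int.cast_abs, Int.abs_eq_natAbs]
        exact_mod_cast this
      have h3 : |lam j * a.1| ≤ B := by
        rw [abs_mul]
        nlinarith [hB j, abs_nonneg (lam j), abs_nonneg (a.1 : ℝ)]
      have := abs_le.1 h3
      have := abs_le.1 (hB i)
      have := abs_le.1 (hB j)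
      linarith) (by
      intro c hc k b p
      obtain ⟨a, q, rfl⟩ := hlift p le_rfl
      linarith [hlam c hc k a q])
  refine ⟨h, fun i a j ha => ?_⟩
  have := hh i _ j ⟨a, ha, rfl⟩
  linarith

end Potential

/-! ## Infinite-weight paths and closed walks of the static graph -/

section Static

variable {n : ℕ} (L C R : RmaxMatrix n)

/-- The static graph: an arc is labelled by its shift and its weight. -/
def StaticE (i : Fin n) (a : ℤ × ℝ) (j : Fin n) : Prop :=
  shiftMatrix L C R a.1 j i = (a.2 : WithBot ℝ)

/-- The `ℕ`-periodic graph, on nodes in `ℤ`. -/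
def PeriodicE (u : Fin n × ℤ) (w : ℝ) (v : Fin n × ℤ) : Prop :=
  1 ≤ u.2 ∧ 1 ≤ v.2 ∧ shiftMatrix L C R (v.2 - u.2) v.1 u.1 = (w : WithBot ℝ)

variable {L C R}

theorem StaticE.natAbs_le {i j : Fin n} {a : ℤ × ℝ} (h : StaticE L C R i a j) :
    a.1.natAbs ≤ 1 := by
  by_contra hc
  have h0 : shiftMatrix L C R a.1 = fun _ _ => ⊥ :=
    (if_neg (by omega)).trans ((if_neg (by omega)).trans (if_neg (by omega)))
  rw [StaticE, h0] at h
  exact WithBot.bot_ne_coe h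

theorem StaticE.exists_bound (L C R : RmaxMatrix n) :
    ∃ M : ℝ, 0 ≤ M ∧ ∀ i a j, StaticE L C R i a j → a.2 ≤ M := by
  obtain ⟨M, hM⟩ := (Set.finite_range fun x : Fin 3 × Fin n × Fin n =>
    (shiftMatrix L C R ((x.1 : ℤ) - 1) x.2.1 x.2.2).unbotD 0).bddAbove
  refine ⟨max M 0, le_max_right _ _, ?_⟩
  rintro i ⟨s, w⟩ j h
  have hs := h.natAbs_le
  simp only at hs
  refine le_trans (hM ⟨(⟨(s + 1).toNat, by omega⟩, j, i), ?_⟩) (le_max_left _ _)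
  have h1 : (((s + 1).toNat : ℕ) : ℤ) - 1 = s := by omega
  simp only [StaticE] at h
  simp only [h1, h, WithBot.unbotD_coe]

theorem exists_path_snoc {V : Type*} {G : WeightedDigraph V} {u v z : V} (p : G.Path u v)
    (h : G.Arc v z) : ∃ q : G.Path u z, q.weight = p.weight + G.weight v z h := by
  induction p with
  | single h' => exact ⟨.cons h' (.single h), rfl⟩
  | cons h' p ih =>
    obtain ⟨q, hq⟩ := ih h
    exact ⟨.cons h' q, by simp only [WeightedDigraph.Path.weight, hq, add_assoc]⟩

theorem PeriodicE.exists_arc {u v : Fin n × ℤ} {w : ℝ} (h : PeriodicE L C R u w v) :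
    ∃ h' : (periodicGraph (Set.Ici (1 : ℤ)) L C R).Arc (u.1, ⟨u.2, h.1⟩) (v.1, ⟨v.2, h.2.1⟩),
      (periodicGraph (Set.Ici (1 : ℤ)) L C R).weight _ _ h' = w := by
  obtain ⟨h1, h2, h3⟩ := h
  refine ⟨by simp [periodicGraph, StaticArc, h3], ?_⟩
  simp [periodicGraph, staticWeight, h3]

theorem PeriodicE.exists_path {l : ℕ} {u v : Fin n × ℤ} {w : ℝ}
    (p : LWalk (PeriodicE L C R) l u w v) (hl : l ≠ 0) :
    ∃ (hu : 1 ≤ u.2) (hv : 1 ≤ v.2), ∃ q : (periodicGraph (Set.Ici (1 : ℤ)) L C R).Path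
      (u.1, ⟨u.2, hu⟩) (v.1, ⟨v.2, hv⟩), q.weight = w := by
  induction p with
  | nil => exact absurd rfl hl
  | @snoc l u v z a b p h ih =>
    obtain ⟨h', hw⟩ := h.exists_arc
    rcases eq_or_ne l 0 with rfl | hl'
    · cases p
      exact ⟨h.1, h.2.1, .single h', by simpa [WeightedDigraph.Path.weight] using hw⟩
    · obtain ⟨hu, hv, q, rfl⟩ := ih hl'
      obtain ⟨q', hq'⟩ := exists_path_snoc q h'
      exact ⟨hu, h.2.1, q', by rw [hq', hw]⟩

/-- Above its length, every walk of the static graph lifts to the periodic graph. -/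
theorem StaticE.lift {l : ℕ} {i j : Fin n} {a : ℤ × ℝ} (p : LWalk (StaticE L C R) l i a j)
    {k : ℤ} (hk : l + 1 ≤ k) : LWalk (PeriodicE L C R) l (i, k) a.2 (j, k + a.1) := by
  induction p with
  | nil => simpa using LWalk.nil (E := PeriodicE L C R) (_, k)
  | @snoc l i m j a b p h ih =>
    have h1 := p.natAbs_fst_le fun _ _ _ => StaticE.natAbs_le
    have h2 := h.natAbs_le
    refine (ih (by push_cast at hk; omega)).snoc ⟨?_, ?_, ?_⟩
    · push_cast at hk; simp only; omega
    · push_cast at hk; simp only [Prod.fst_add]; omega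
    · simpa [StaticE, add_sub_add_left_eq_sub, ← add_assoc] using h

/-- Turns of nonnegative shift never lower the level at which the next turn starts, so each of them
lifts. -/
theorem StaticE.lift_up {l : ℕ} {i : Fin n} {s : ℤ} {w : ℝ}
    (p : LWalk (StaticE L C R) l i (s, w) i) (hs : 0 ≤ s) {k : ℤ} (hk : l + 1 ≤ k) (m : ℕ) :
    ∃ l', LWalk (PeriodicE L C R) l' (i, k) (m * w) (i, k + m * s) := by
  induction m with
  | zero => exact ⟨0, by simpa using LWalk.nil (E := PeriodicE L C R) (i, k)⟩
  | succ m ih =>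
    obtain ⟨l', q⟩ := ih
    have := q.trans (StaticE.lift p (k := k + m * s) (by nlinarith))
    refine ⟨l' + l, ?_⟩
    push_cast
    rw [add_one_mul, add_one_mul, ← add_assoc]
    exact this

/-- The induction puts the new turn in front, at the top: every turn ends at level at least `k` and
hence starts at one. -/
theorem StaticE.lift_down {l : ℕ} {i : Fin n} {s : ℤ} {w : ℝ}
    (p : LWalk (StaticE L C R) l i (-s, w) i) (hs : 0 ≤ s) {k : ℤ} (hk : l + 1 ≤ k) (m : ℕ) :
    ∃ l', LWalk (PeriodicE L C R) l' (i, k + m * s) (m * w) (i, k) := by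
  induction m with
  | zero => exact ⟨0, by simpa using LWalk.nil (E := PeriodicE L C R) (i, k)⟩
  | succ m ih =>
    obtain ⟨l', q⟩ := ih
    have h := StaticE.lift p (k := k + (m + 1) * s) (by nlinarith)
    rw [show k + (m + 1) * s + (-s, w).1 = k + m * s by simp only; ring] at h
    refine ⟨l + l', ?_⟩
    push_cast
    rw [add_one_mul (m : ℝ), add_comm (m * w)]
    exact h.trans q

/-- Closed walks that go up and down, with a walk from the first to the second, yield an
infinite-weight path if their combination of shift zero has positive weight. -/
theorem infWeightNPath_of_walks {i j : Fin n} {l : ℕ} {a : ℤ × ℝ}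
    (p : LWalk (StaticE L C R) l i a j) {s₁ s₂ : ℕ} {w₁ w₂ : ℝ}
    (h₁ : s₂ = 0 ∨ ∃ l₁, LWalk (StaticE L C R) l₁ i (s₁, w₁) i)
    (h₂ : s₁ = 0 ∨ ∃ l₂, LWalk (StaticE L C R) l₂ j (-s₂, w₂) j)
    (hpos : 0 < s₂ * w₁ + s₁ * w₂) : InfWeightNPath L C R := by
  obtain ⟨K₁, hK₁⟩ : ∃ K₁ : ℕ, ∀ k : ℤ, K₁ ≤ k → ∀ m : ℕ, ∃ l',
      LWalk (PeriodicE L C R) l' (i, k) (m * (s₂ * w₁)) (i, k + m * (s₁ * s₂)) := by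
    rcases h₁ with rfl | ⟨l₁, q⟩
    · exact ⟨0, fun k _ m => ⟨0, by simpa using LWalk.nil (E := PeriodicE L C R) (i, k)⟩⟩
    · refine ⟨l₁ + 1, fun k hk m => ?_⟩
      have := StaticE.lift_up q (by positivity) (k := k) (by exact_mod_cast hk) (m * s₂)
      push_cast at this
      rwa [mul_assoc, mul_assoc, mul_comm (s₂ : ℤ)] at this
  obtain ⟨K₂, hK₂⟩ : ∃ K₂ : ℕ, ∀ k : ℤ, K₂ ≤ k → ∀ m : ℕ, ∃ l',
      LWalk (PeriodicE L C R) l' (j, k + m * (s₁ * s₂)) (m * (s₁ * w₂)) (j, k) := by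
    rcases h₂ with rfl | ⟨l₂, q⟩
    · exact ⟨0, fun k _ m => ⟨0, by simpa using LWalk.nil (E := PeriodicE L C R) (j, k)⟩⟩
    · refine ⟨l₂ + 1, fun k hk m => ?_⟩
      have := StaticE.lift_down q (by positivity) (k := k) (by exact_mod_cast hk) (m * s₁)
      push_cast at this
      rwa [mul_assoc, mul_assoc] at this
  obtain ⟨s, w⟩ := a
  have hs := p.natAbs_fst_le fun _ _ _ => StaticE.natAbs_le
  simp only at hs
  -- High enough to lift `p`, and such that after `p`, whose shift is at least `-l`, the level is
  -- still at least `K₂`.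
  set k : ℤ := K₁ + K₂ + l + l + 1 with hk
  have key : ∀ m : ℕ, ∃ l', LWalk (PeriodicE L C R) l' (i, k) (m * (s₂ * w₁ + s₁ * w₂) + w)
      (j, k + s) := by
    intro m
    obtain ⟨l₁, q₁⟩ := hK₁ k (by omega) m
    obtain ⟨l₂, q₂⟩ := hK₂ (k + s) (by omega) m
    have hm : (0 : ℤ) ≤ m * (s₁ * s₂) := by positivity
    have q := StaticE.lift p (k := k + m * (s₁ * s₂)) (by omega)
    rw [add_right_comm] at q₂
    refine ⟨l₁ + l + l₂, ?_⟩
    convert (q₁.trans q).trans q₂ using 1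
    simp only
    ring
  have hlim : Filter.Tendsto (fun m : ℕ => (m : ℝ) * (s₂ * w₁ + s₁ * w₂) + w)
      Filter.atTop Filter.atTop :=
    Filter.tendsto_atTop_add_const_right _ _
      (tendsto_natCast_atTop_atTop.atTop_mul_const hpos)
  -- Paths need at least one arc; from `m₀` on the weight is positive, so the walk cannot be empty.
  obtain ⟨m₀, hm₀⟩ := Filter.eventually_atTop.1 (hlim.eventually_gt_atTop 0)
  have hpath : ∀ m : ℕ, ∃ (hu : 1 ≤ k) (hv : 1 ≤ k + s),
      ∃ q : (periodicGraph (Set.Ici (1 : ℤ)) L C R).Path (i, ⟨k, hu⟩) (j, ⟨k + s, hv⟩),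
        q.weight = ((m + m₀ : ℕ) : ℝ) * (s₂ * w₁ + s₁ * w₂) + w := by
    intro m
    obtain ⟨l', q⟩ := key (m + m₀)
    refine PeriodicE.exists_path q ?_
    rintro rfl
    exact (hm₀ (m + m₀) (by omega)).ne' q.label_eq_zero
  obtain ⟨hu, hv, -⟩ := hpath 0
  choose _ _ q hq using hpath
  refine ⟨(i, ⟨k, hu⟩), (j, ⟨k + s, hv⟩), q, ?_⟩
  simp only [hq]
  exact hlim.comp (Filter.tendsto_add_atTop_nat m₀)

/-- Without positive combinations of short closed walks there is no infinite-weight path. -/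
theorem not_infWeightNPath
    (hZ : ∀ l ≤ n, ∀ i w, LWalk (StaticE L C R) l i (0, w) i → w ≤ 0)
    (hP : ∀ i j l a, LWalk (StaticE L C R) l i a j → ∀ l₁ ≤ n, ∀ l₂ ≤ n, ∀ s₁ s₂ : ℤ,
      0 < s₁ → 0 < s₂ → ∀ w₁ w₂ : ℝ, LWalk (StaticE L C R) l₁ i (s₁, w₁) i →
      LWalk (StaticE L C R) l₂ j (-s₂, w₂) j → s₂ * w₁ + s₁ * w₂ ≤ 0) :
    ¬ InfWeightNPath L C R := by
  obtain ⟨M, hM0, hM⟩ := StaticE.exists_bound L C R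
  obtain ⟨lam, hmono, hlam⟩ := exists_slope n hM0 hM hZ hP
  obtain ⟨h, hh⟩ := exists_periodic_potential hM (fun _ _ _ => StaticE.natAbs_le) hmono
    (by simpa using hlam)
  have key : ∀ (u v : Fin n × Set.Ici (1 : ℤ))
      (p : (periodicGraph (Set.Ici (1 : ℤ)) L C R).Path u v),
      p.weight ≤ (lam v.1 * (v.2 : ℤ) + h v.1) - (lam u.1 * (u.2 : ℤ) + h u.1) := by
    have harc : ∀ (u v : Fin n × Set.Ici (1 : ℤ))
        (ha : (periodicGraph (Set.Ici (1 : ℤ)) L C R).Arc u v),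
        (periodicGraph (Set.Ici (1 : ℤ)) L C R).weight u v ha ≤
          (lam v.1 * (v.2 : ℤ) + h v.1) - (lam u.1 * (u.2 : ℤ) + h u.1) := by
      rintro ⟨i, k, hk⟩ ⟨j, k', hk'⟩ ha
      have hE : StaticE L C R i (k' - k, (periodicGraph (Set.Ici (1 : ℤ)) L C R).weight _ _ ha) j :=
        (WithBot.coe_unbot _ ha).symm
      have h1 := hh _ _ _ hE
      have h2 := hmono _ _ _ hE
      have hk1 : (1 : ℝ) ≤ k := by exact_mod_cast hk
      push_cast at h1 ⊢
      -- The half-line enters here: `(lam j - lam i) * (k - 1) ≥ 0` since slopes increase and `k ≥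
      -- 1`.
      nlinarith
    intro u v p
    induction p with
    | single ha => exact harc _ _ ha
    | cons ha p ih =>
      have := harc _ _ ha
      simp only [WeightedDigraph.Path.weight]
      linarith
  rintro ⟨u, v, p, hp⟩
  obtain ⟨m, hm⟩ := (hp.eventually_gt_atTop
    ((lam v.1 * (v.2 : ℤ) + h v.1) - (lam u.1 * (u.2 : ℤ) + h u.1))).exists
  exact absurd (key u v (p m)) (not_le.2 hm)

end Static

namespace ArithRAM

/-! ## Computing the weights of walks -/

/-- Registers `0` to `7`: the constants `n`, `1`, `0`, `n + 1`, `(n + 1) n`, `2 n + 1`,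
`(2 n + 1) n`, `2 n + 2`. -/
structure Regs (n : ℕ) (σ : Memory) : Prop where
  r0 : σ.reg 0 = n
  r1 : σ.reg 1 = 1
  r2 : σ.reg 2 = 0
  r3 : σ.reg 3 = n + 1
  r4 : σ.reg 4 = (n + 1) * n
  r6 : σ.reg 6 = (2 * n + 1) * n
  r7 : σ.reg 7 = 2 * n + 2

theorem Regs.agree {n b : ℕ} {σ τ : Memory} (h : Regs n σ) (ha : Agree b σ τ) (hb : 8 ≤ b) :
    Regs n τ := by
  obtain ⟨h0, h1, h2, h3, h4, h6, h7⟩ := h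
  constructor <;> rw [ha _ (by omega)] <;> assumption

theorem loop_time_le {n N T b c d e : ℕ} (hn : 1 ≤ n) (hN : N ≤ b * n ^ e) (hT : T ≤ c * n ^ d) :
    N * (T + 3) + 3 ≤ (b * (c + 3) + 3) * n ^ (e + d) := by
  have h1 : 1 ≤ n ^ d := Nat.one_le_pow _ _ hn
  have h2 : 1 ≤ n ^ (e + d) := Nat.one_le_pow _ _ hn
  calc N * (T + 3) + 3 ≤ b * n ^ e * (c * n ^ d + 3 * n ^ d) + 3 * n ^ (e + d) := by
        gcongr <;> omega
    _ = _ := by ring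

/-- Compute `A[p + n][k] + X[j][k]`, where `X` is the array `x`, and raise `A[q][j]` to at least
this value. -/
def relax (x q : ℕ) : Prog :=
  .seq (.cellAdd ⟨4, 2, 2⟩ ⟨3, 10, 13⟩ ⟨x, 12, 13⟩)
    (.ite (.cellLe ⟨4, 2, 2⟩ ⟨3, q, 12⟩) .skip (.cellCopy ⟨3, q, 12⟩ ⟨4, 2, 2⟩))

/-- One round of relaxations. -/
def relaxRound : Prog :=
  .for 9 6 (.seq (.regAdd 10 9 0) (.seq (.regAdd 11 10 0)
    (.for 12 0 (.for 13 0 (.seq (relax 0 9) (.seq (relax 1 10) (relax 2 11)))))))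

section Relax

variable {n : ℕ} (L C R : RmaxMatrix n) (Y : Arrays)

/-- Every finite entry `A[(s + n + 1) n + i][j]` is the weight of a walk from `i` to `j` with
shift `s`. -/
def Sound (A : ℕ → ℕ → WithBot ℝ) : Prop :=
  ∀ (q j : ℕ) (w : ℝ), A q j = w → ∃ (hj : j < n) (i : Fin n) (l : ℕ), q % n = i ∧
    LWalk (StaticE L C R) l i (((q / n : ℕ) : ℤ) - (n + 1), w) ⟨j, hj⟩

/-- The entry `A[(s + n + 1) n + i][j]` is at least the weight of all walks of length at most `m`
from `i` to `j` with shift `s`. -/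
def Complete (m : ℕ) (A : ℕ → ℕ → WithBot ℝ) : Prop :=
  ∀ l ≤ m, ∀ (i j : Fin n) (s : ℤ) (w : ℝ), LWalk (StaticE L C R) l i (s, w) j →
    (w : WithBot ℝ) ≤ A ((s + (n + 1)).toNat * n + i) j

/-- The array `3` is sound, and all arrays but `3` and the scratch array `4` are as in `Y`. -/
def Good (a : Arrays) : Prop :=
  (∀ x, x ≠ 3 → x ≠ 4 → a x = Y x) ∧ Sound L C R (a 3)

/-- The arrays `0`, `1`, `2` hold the matrices of shift `-1`, `0`, `1`. -/
def HoldsInstance : Prop :=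
  ∀ (x : ℕ) (j k : Fin n), x < 3 → Y x j k = shiftMatrix L C R ((x : ℤ) - 1) j k

variable {L C R Y}

theorem HoldsInstance.staticE (hY : HoldsInstance L C R Y) {x : ℕ} {j k : Fin n} {w : ℝ}
    (hx : x < 3) (h : Y x j k = w) : StaticE L C R k ((x : ℤ) - 1, w) j := by
  rw [hY x j k hx] at h
  exact h

/-- The effect of all relaxations of the target entries by `A[p + n][k]` and `X[j][k]`. -/
def Relaxed (n : ℕ) (Y : Arrays) (p j k x : ℕ) (a b : Arrays) : Prop :=
  a 3 (p + n) k + Y x j k ≤ b 3 (p + x * n) j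

theorem Relaxed.of_le_left {p j k x : ℕ} {a b c : Arrays} (h : a 3 ≤ b 3)
    (h' : Relaxed n Y p j k x b c) : Relaxed n Y p j k x a c :=
  (add_le_add_left (h _ _) _).trans h'

theorem Relaxed.of_le_right {p j k x : ℕ} {a b c : Arrays} (h : Relaxed n Y p j k x a b)
    (h' : b 3 ≤ c 3) : Relaxed n Y p j k x a c :=
  le_trans h (h' _ _)

/-- A source row in block `p / n + 1` and a target row `p + x * n` have the same residue mod `n`,
hence the same start node, and their shifts differ by `x - 1`, the shift of the matrix in array `x`.
So appending the arc preserves soundness. -/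
theorem relax_does (hY : HoldsInstance L C R Y) {σ : Memory}
    (hG : Good L C R Y σ.arr) {x q p j k : ℕ} (hx : x < 3) (hp : σ.reg 10 = p + n)
    (hq : σ.reg q = p + x * n) (hj : σ.reg 12 = j) (hk : σ.reg 13 = k) (hjn : j < n) :
    Does (relax x q) σ 4 fun τ => τ.reg = σ.reg ∧ Good L C R Y τ.arr ∧ σ.arr 3 ≤ τ.arr 3 ∧
      Relaxed n Y p j k x σ.arr τ.arr := by
  have hn : 0 < n := by omega
  refine (Does.seq (T := 1) (T' := 1 + 1) (Does.cellAdd ?_)).le (by omega)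
  have hYx : σ.arr x = Y x := hG.1 x (by omega) (by omega)
  have hget : σ.get ⟨3, 10, 13⟩ + σ.get ⟨x, 12, 13⟩ = σ.arr 3 (p + n) k + Y x j k := by
    simp only [Memory.get, hp, hj, hk, hYx]
  rw [hget]
  set v := σ.arr 3 (p + n) k + Y x j k with hv
  set τ := σ.set ⟨4, 2, 2⟩ v with hτ
  have h3 : τ.arr 3 = σ.arr 3 := Memory.set_arr_of_ne _ _ _ (by simp)
  have hreg : τ.reg = σ.reg := rfl
  have h4 : τ.get ⟨4, 2, 2⟩ = v := by
    simp only [Memory.get]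
    rw [hτ, Memory.set_arr_name _ ⟨4, 2, 2⟩]
    simp
  have hother : ∀ y, y ≠ 3 → y ≠ 4 → τ.arr y = Y y := fun y hy3 hy4 => by
    rw [Memory.set_arr_of_ne _ _ _ hy4, hG.1 y hy3 hy4]
  refine Does.ite ?_ ?_
  · intro hle
    simp only [Test.Holds, h4] at hle
    simp only [Memory.get, h3, hreg, hq, hj] at hle
    refine Does.skip ⟨rfl, ⟨hother, h3 ▸ hG.2⟩, h3.ge, ?_⟩
    rw [Relaxed, h3]
    exact hle
  · intro hle
    simp only [Test.Holds, h4] at hle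
    simp only [Memory.get, h3, hreg, hq, hj, not_le] at hle
    refine Does.cellCopy ?_
    rw [h4]
    have hset : ∀ i' j', (τ.set ⟨3, q, 12⟩ v).arr 3 i' j' =
        if i' = p + x * n ∧ j' = j then v else σ.arr 3 i' j' := by
      intro i' j'
      rw [Memory.set_arr_name τ ⟨3, q, 12⟩]
      simp only [hreg, hq, hj, h3]
    refine ⟨rfl, ⟨fun y hy3 hy4 => ?_, ?_⟩, ?_, ?_⟩
    · rw [Memory.set_arr_of_ne _ _ _ hy3, hother y hy3 hy4]
    · intro q' j' w hw
      rw [hset] at hw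
      split_ifs at hw with h
      · obtain ⟨rfl, rfl⟩ := h
        obtain ⟨w₁, w₂, h1, h2, rfl⟩ := WithBot.add_eq_coe.1 hw
        obtain ⟨hk', i, l, hi, hwalk⟩ := hG.2 _ _ _ h1.symm
        refine ⟨hjn, i, l + 1, ?_, ?_⟩
        · rw [← hi]; simp
        · have := hwalk.snoc (hY.staticE (j := ⟨j', hjn⟩) (k := ⟨k, hk'⟩) hx h2.symm)
          convert this using 1
          rw [Nat.add_mul_div_right _ _ hn, Nat.add_div_right _ hn, Prod.mk_add_mk]
          push_cast
          congr 1
          ring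
      · exact hG.2 _ _ _ hw
    · intro i' j'
      rw [hset]
      split_ifs with h
      · obtain ⟨rfl, rfl⟩ := h; exact hle.le
      · exact le_rfl
    · rw [Relaxed, hset]
      simp [hv]

/-- Updating in place is harmless: entries only grow, so an inequality against the array at the
start of the round persists, and soundness allows walks of any length. -/
theorem relaxRound_does (hn : 1 ≤ n) (hY : HoldsInstance L C R Y) {σ : Memory} (hσ : Regs n σ)
    (hG : Good L C R Y σ.arr) :
    Does relaxRound σ (108 * n ^ 4) fun τ => Agree 9 σ τ ∧ Good L C R Y τ.arr ∧
      σ.arr 3 ≤ τ.arr 3 ∧ ∀ p < (2 * n + 1) * n, ∀ j < n, ∀ k < n, ∀ x < 3,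
        Relaxed n Y p j k x σ.arr τ.arr := by
  have e1 : n * (14 + 3) + 3 ≤ _ := loop_time_le (b := 1) (e := 1) (c := 14) (d := 0) hn
    (by simp) (by simp)
  have e2 : n * (n * (14 + 3) + 3 + 3) + 3 ≤ _ := loop_time_le (b := 1) (e := 1) hn (by simp) e1
  have e3 : (2 * n + 1) * n * (1 + (1 + (n * (n * (14 + 3) + 3 + 3) + 3) + 1) + 1 + 3) + 3 ≤ _ :=
    loop_time_le (b := 3) (e := 2) (c := 30) (d := 2) hn (by nlinarith)
      (by
        have : 1 ≤ n ^ 2 := Nat.one_le_pow _ _ hn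
        norm_num at e2 ⊢
        omega)
  refine (Does.for_forall (Good L C R Y) (fun a b => a 3 ≤ b 3)
    (fun p a b => ∀ j < n, ∀ k < n, ∀ x < 3, Relaxed n Y p j k x a b)
    (fun a => le_rfl) (fun a b c => le_trans)
    (fun p a b c h h' j hj k hk x hx => .of_le_left h (h' j hj k hk x hx))
    (fun p a b c h h' j hj k hk x hx => .of_le_right (h j hj k hk x hx) h')
    hσ.r1 (by omega) (by omega) hσ.r6 hG ?_).le
    (T := (2 * n + 1) * n * (1 + (1 + (n * (n * (14 + 3) + 3 + 3) + 3) + 1) + 1 + 3) + 3)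
    (e3.trans (Nat.mul_le_mul_right _ (by norm_num)))
  intro p hp τ ha hτ9 hGτ
  have hτ := hσ.agree ha (by omega)
  refine Does.seq (Does.regAdd (Does.seq (Does.regAdd ?_)))
  set υ := (τ.setReg 10 (τ.reg 9 + τ.reg 0)).setReg 11
    ((τ.setReg 10 (τ.reg 9 + τ.reg 0)).reg 10 + (τ.setReg 10 (τ.reg 9 + τ.reg 0)).reg 0) with hυdef
  have haυ : Agree 10 τ υ := ((Agree.refl _ _).setReg (by omega) _).setReg (by omega) _
  have hυ := hτ.agree haυ (by omega)
  have hυ9 : υ.reg 9 = p := by rw [haυ _ (by omega), hτ9]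
  have hυ10 : υ.reg 10 = p + n := by simp [hυdef, Memory.setReg_reg_of_ne, hτ9, hτ.r0]
  have hυ11 : υ.reg 11 = p + 2 * n := by
    simp [hυdef, Memory.setReg_reg_of_ne, hτ9, hτ.r0, two_mul, add_assoc]
  refine (Does.for_forall (Good L C R Y) (fun a b => a 3 ≤ b 3)
    (fun j a b => ∀ k < n, ∀ x < 3, Relaxed n Y p j k x a b)
    (fun a => le_rfl) (fun a b c => le_trans)
    (fun j a b c h h' k hk x hx => .of_le_left h (h' k hk x hx))
    (fun j a b c h h' k hk x hx => .of_le_right (h k hk x hx) h')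
    hυ.r1 (by omega) (by omega) hυ.r0 hGτ ?_).mono le_rfl
      fun ω hω => ⟨haυ.trans (hω.1.anti (by omega)), hω.2⟩
  intro j hj φ haφ hφ12 hGφ
  have hφ := hυ.agree haφ (by omega)
  refine (Does.for_forall (Good L C R Y) (fun a b => a 3 ≤ b 3)
    (fun k a b => ∀ x < 3, Relaxed n Y p j k x a b)
    (fun a => le_rfl) (fun a b c => le_trans)
    (fun k a b c h h' x hx => .of_le_left h (h' x hx))
    (fun k a b c h h' x hx => .of_le_right (h x hx) h')
    hφ.r1 (by omega) (by omega) hφ.r0 hGφ ?_)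
  intro k hk ψ haψ hψ13 hGψ
  have hψ9 : ψ.reg 9 = p := by rw [haψ _ (by omega), haφ _ (by omega), hυ9]
  have hψ10 : ψ.reg 10 = p + n := by rw [haψ _ (by omega), haφ _ (by omega), hυ10]
  have hψ11 : ψ.reg 11 = p + 2 * n := by rw [haψ _ (by omega), haφ _ (by omega), hυ11]
  have hψ12 : ψ.reg 12 = j := by rw [haψ _ (by omega), hφ12]
  refine Does.seq (T := 4) (T' := 9) ((relax_does hY hGψ (x := 0) (by omega) hψ10
    (by simpa using hψ9) hψ12 hψ13 hj).mono le_rfl ?_)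
  rintro ψ₁ ⟨hr1, hG1, hS1, hR1⟩
  refine Does.seq (T := 4) (T' := 4) ((relax_does hY hG1 (x := 1) (by omega) (hr1 ▸ hψ10)
    (by rw [hr1, one_mul]; exact hψ10) (hr1 ▸ hψ12) (hr1 ▸ hψ13) hj).mono le_rfl ?_)
  rintro ψ₂ ⟨hr2, hG2, hS2, hR2⟩
  rw [hr1] at hr2
  refine (relax_does hY hG2 (x := 2) (by omega) (hr2 ▸ hψ10)
    (by rw [hr2]; exact hψ11) (hr2 ▸ hψ12) (hr2 ▸ hψ13) hj).mono le_rfl ?_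
  rintro ψ₃ ⟨hr3, hG3, hS3, hR3⟩
  rw [hr2] at hr3
  refine ⟨fun r _ => by rw [hr3], hG3, hS1.trans (hS2.trans hS3), fun x hx => ?_⟩
  interval_cases x
  · exact hR1.of_le_right (hS2.trans hS3)
  · exact (hR2.of_le_left hS1).of_le_right hS3
  · exact hR3.of_le_left (hS1.trans hS2)

/-- Split off the last arc. The remaining walk has shift between `-m` and `m` with `m < n`, so its
row is among the `2 n + 1` source blocks; the numbering leaves one further block on either side for
the targets. -/
theorem Complete.succ (hY : HoldsInstance L C R Y) {m : ℕ} (hm : m < n) {a b : Arrays}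
    (ha : Complete L C R m (a 3)) (hab : a 3 ≤ b 3)
    (h : ∀ p < (2 * n + 1) * n, ∀ j < n, ∀ k < n, ∀ x < 3, Relaxed n Y p j k x a b) :
    Complete L C R (m + 1) (b 3) := by
  intro l hl i j s w p
  rcases Nat.le_succ_iff.1 hl with hl | rfl
  · exact (ha l hl i j s w p).trans (hab _ _)
  generalize hc : (s, w) = c at p
  cases p with
  | @snoc _ _ k _ c d p hE =>
    obtain ⟨s₁, w₁⟩ := c
    obtain ⟨s₂, w₂⟩ := d
    simp only [Prod.mk_add_mk, Prod.mk.injEq] at hc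
    obtain ⟨rfl, rfl⟩ := hc
    have hs1 : s₁.natAbs ≤ m := p.natAbs_fst_le fun _ _ _ => StaticE.natAbs_le
    have hs2 : s₂.natAbs ≤ 1 := hE.natAbs_le
    have hi := i.2
    have hp : (s₁ + n).toNat * n + i < (2 * n + 1) * n := by
      have : (s₁ + n).toNat ≤ 2 * n := by omega
      nlinarith
    have hx := h _ hp j j.2 k k.2 (s₂ + 1).toNat (by omega)
    have h1 := ha m le_rfl i k s₁ w₁ p
    rw [Relaxed, hY _ _ _ (by omega)] at hx
    have e1 : (((s₂ + 1).toNat : ℕ) : ℤ) - 1 = s₂ := by omega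
    have e2 : (s₁ + (n + 1)).toNat = (s₁ + n).toNat + 1 := by omega
    have e3 : (s₁ + s₂ + (n + 1)).toNat = (s₁ + n).toNat + (s₂ + 1).toNat := by omega
    simp only [StaticE] at hE
    rw [e1, hE] at hx
    rw [e2] at h1
    rw [e3, WithBot.coe_add]
    refine (add_le_add_left h1 _).trans (le_trans (le_of_eq ?_) (hx.trans (le_of_eq ?_)))
    · congr 2; ring
    · congr 1; ring

/-- Walks of length zero. -/
def initWalks : Prog := .for 8 0 (.seq (.regAdd 9 4 8) (.cellZero ⟨3, 9, 8⟩))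

/-- The weights of all walks of length at most `n`. -/
def computeWalks : Prog := .seq initWalks (.for 8 0 relaxRound)

theorem initWalks_does (hn : 1 ≤ n) {σ : Memory} (hσ : Regs n σ) (hG : Good L C R Y σ.arr) :
    Does initWalks σ (9 * n) fun τ => Agree 8 σ τ ∧ Good L C R Y τ.arr ∧
      Complete L C R 0 (τ.arr 3) := by
  refine (Does.for (T := 3) (fun m a => Good L C R Y a ∧ ∀ i < m, 0 ≤ a 3 ((n + 1) * n + i) i)
    hσ.r1 (by omega) (by omega) hσ.r0 ⟨hG, by simp⟩ ?_).mono (by omega) ?_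
  · rintro i hi τ ha hτ8 ⟨hGτ, hI⟩
    have hτ := hσ.agree ha le_rfl
    refine Does.seq (Does.regAdd (Does.cellZero ?_))
    set υ := τ.setReg 9 (τ.reg 4 + τ.reg 8) with hυ
    have h8 : υ.reg 8 = i := by simp [hυ, Memory.setReg_reg_of_ne, hτ8]
    have h9 : υ.reg 9 = (n + 1) * n + i := by simp [hυ, hτ8, hτ.r4]
    have hset : ∀ q j, (υ.set ⟨3, 9, 8⟩ 0).arr 3 q j =
        if q = (n + 1) * n + i ∧ j = i then 0 else τ.arr 3 q j := by
      intro q j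
      rw [Memory.set_arr_name υ ⟨3, 9, 8⟩]
      simp only [h8, h9]
      rfl
    refine ⟨((Agree.refl _ _).setReg le_rfl _).set _ _, ⟨fun y hy3 hy4 => ?_, ?_⟩, ?_⟩
    · rw [Memory.set_arr_of_ne _ _ _ hy3]
      exact hGτ.1 y hy3 hy4
    · intro q j w hw
      rw [hset] at hw
      split_ifs at hw with h
      · obtain ⟨rfl, rfl⟩ := h
        have hw0 : w = 0 := by exact_mod_cast hw.symm
        refine ⟨hi, ⟨j, hi⟩, 0, ?_, ?_⟩
        · simp [Nat.mod_eq_of_lt hi]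
        · rw [hw0, mul_comm, Nat.mul_add_div hn, Nat.div_eq_of_lt hi]
          convert LWalk.nil (E := StaticE L C R) ⟨j, hi⟩ using 1
          simp
      · exact hGτ.2 _ _ _ hw
    · intro i' hi'
      rw [hset]
      split_ifs with h
      · exact le_rfl
      · exact hI i' (by
          rcases Nat.lt_succ_iff_lt_or_eq.1 hi' with h' | rfl
          · exact h'
          · exact absurd ⟨rfl, rfl⟩ h)
  · rintro τ ⟨ha, hGτ, hI⟩
    refine ⟨ha, hGτ, fun l hl i j s w p => ?_⟩
    obtain rfl : l = 0 := by omega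
    generalize hc : (s, w) = c at p
    cases p
    obtain ⟨rfl, rfl⟩ := Prod.mk.inj hc
    simpa using hI i i.2

theorem computeWalks_does (hn : 1 ≤ n) (hY : HoldsInstance L C R Y) {σ : Memory} (hσ : Regs n σ)
    (hG : Good L C R Y σ.arr) :
    Does computeWalks σ (124 * n ^ 5) fun τ => Agree 8 σ τ ∧ Good L C R Y τ.arr ∧
      Complete L C R n (τ.arr 3) := by
  have e : n * (108 * n ^ 4 + 3) + 3 ≤ _ := loop_time_le (b := 1) (e := 1) hn (by simp) le_rfl
  have hn5 : n ≤ n ^ 5 := Nat.le_self_pow (by norm_num) n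
  refine (Does.seq ((initWalks_does hn hσ hG).mono le_rfl ?_)).le
    (T := 9 * n + (n * (108 * n ^ 4 + 3) + 3) + 1) (by norm_num at e; omega)
  rintro τ ⟨ha, hGτ, hC⟩
  have hτ := hσ.agree ha le_rfl
  refine (Does.for (fun m a => Good L C R Y a ∧ Complete L C R m (a 3)) hτ.r1 (by omega)
    (by omega) hτ.r0 ⟨hGτ, hC⟩ ?_).mono le_rfl fun υ h => ⟨ha.trans h.1, h.2⟩
  rintro m hm υ haυ - ⟨hGυ, hCυ⟩
  refine (relaxRound_does hn hY (hτ.agree haυ le_rfl) hGυ).mono le_rfl ?_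
  rintro ω ⟨hω, hGω, hS, hR⟩
  exact ⟨hω, hGω, hCυ.succ hY hm hS hR⟩

end Relax

/-! ## Evaluating the criterion -/

open Classical in
/-- `0` if a walk from `i` to `j` is recorded in `A`, and `-∞` otherwise. -/
noncomputable def reachValue (n : ℕ) (A : ℕ → ℕ → WithBot ℝ) (i j m : ℕ) : WithBot ℝ :=
  if ∃ s < m, A (s * n + i) j ≠ ⊥ then 0 else ⊥

/-- The combination of a closed walk at `i` of shift `s₁` and a closed walk at `j` of shift `-s₂`,
with a walk from `i` to `j`, has positive weight. -/
def Positive (n : ℕ) (A : ℕ → ℕ → WithBot ℝ) (i j s₁ s₂ : ℕ) : Prop :=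
  0 < reachValue n A i j (2 * n + 2) + s₂ • A ((s₁ + (n + 1)) * n + i) i +
    s₁ • A ((n + 1 - s₂) * n + j) j

/-- Since `0 • ⊥ = 0`, a zero coefficient does not require the closed walk to exist; this matches
the alternatives in `infWeightNPath_of_walks`. -/
theorem exists_coe_of_nsmul_ne_bot {m : ℕ} {x : WithBot ℝ} (h : m • x ≠ ⊥) :
    m = 0 ∨ ∃ w : ℝ, x = w := by
  induction x with
  | bot =>
    left
    by_contra hm
    obtain ⟨k, rfl⟩ := Nat.exists_eq_succ_of_ne_zero hm
    exact h (by rw [succ_nsmul, WithBot.add_bot])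
  | coe w => exact Or.inr ⟨w, rfl⟩

section Criterion

variable {n : ℕ} {L C R : RmaxMatrix n} {A : ℕ → ℕ → WithBot ℝ}

/-- A positive sum is not `-∞`, so all three summands are finite, and soundness turns them into
walks. Their lengths play no role in this direction. -/
theorem infWeightNPath_of_positive (hA : Sound L C R A) {i j s₁ s₂ : ℕ} (hi : i < n)
    (hs₂ : s₂ < n + 1) (h : Positive n A i j s₁ s₂) : InfWeightNPath L C R := by
  have hn : 0 < n := by omega
  obtain ⟨h1, h2⟩ := WithBot.add_ne_bot.1 (ne_bot_of_gt h)
  obtain ⟨h0, h1⟩ := WithBot.add_ne_bot.1 h1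
  have hex : ∃ s < 2 * n + 2, A (s * n + i) j ≠ ⊥ := by
    by_contra hc
    exact h0 (if_neg hc)
  have hv : reachValue n A i j (2 * n + 2) = 0 := if_pos hex
  obtain ⟨s, -, hs⟩ := hex
  obtain ⟨w, hw⟩ := WithBot.ne_bot_iff_exists.1 hs
  obtain ⟨hj, i', l, hi', p⟩ := hA _ _ _ hw.symm
  have key : ∀ (t k : ℕ) (hk : k < n) (x : ℝ), A (t * n + k) k = x →
      ∃ l, LWalk (StaticE L C R) l ⟨k, hk⟩ ((t : ℤ) - (n + 1), x) ⟨k, hk⟩ := by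
    intro t k hk x hx
    obtain ⟨_, k', l, hk', q⟩ := hA _ _ _ hx
    rw [mul_comm, Nat.mul_add_mod, Nat.mod_eq_of_lt hk] at hk'
    rw [mul_comm, Nat.mul_add_div hn, Nat.div_eq_of_lt hk] at q
    obtain rfl : k' = ⟨k, hk⟩ := Fin.ext hk'.symm
    exact ⟨l, q⟩
  rw [mul_comm, Nat.mul_add_mod, Nat.mod_eq_of_lt hi] at hi'
  obtain rfl : i' = ⟨i, hi⟩ := Fin.ext hi'.symm
  obtain ⟨w₁, hw₁, hq₁⟩ : ∃ w₁ : ℝ, s₂ • A ((s₁ + (n + 1)) * n + i) i = ((s₂ * w₁ : ℝ) :) ∧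
      (s₂ = 0 ∨ ∃ l₁, LWalk (StaticE L C R) l₁ ⟨i, hi⟩ (s₁, w₁) ⟨i, hi⟩) := by
    rcases exists_coe_of_nsmul_ne_bot h1 with rfl | ⟨x, hx⟩
    · exact ⟨0, by simp, Or.inl rfl⟩
    · refine ⟨x, by rw [hx, ← WithBot.coe_nsmul, nsmul_eq_mul], Or.inr ?_⟩
      simpa using key _ _ hi _ hx
  obtain ⟨w₂, hw₂, hq₂⟩ : ∃ w₂ : ℝ, s₁ • A ((n + 1 - s₂) * n + j) j = ((s₁ * w₂ : ℝ) :) ∧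
      (s₁ = 0 ∨ ∃ l₂, LWalk (StaticE L C R) l₂ ⟨j, hj⟩ (-s₂, w₂) ⟨j, hj⟩) := by
    rcases exists_coe_of_nsmul_ne_bot h2 with rfl | ⟨x, hx⟩
    · exact ⟨0, by simp, Or.inl rfl⟩
    · refine ⟨x, by rw [hx, ← WithBot.coe_nsmul, nsmul_eq_mul], Or.inr ?_⟩
      simpa [Nat.cast_sub hs₂.le] using key _ _ hj _ hx
  rw [Positive, hv, hw₁, hw₂, zero_add, ← WithBot.coe_add] at h
  exact infWeightNPath_of_walks p hq₁ hq₂ (by exact_mod_cast h)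

theorem exists_positive (hA : Complete L C R n A) (h : InfWeightNPath L C R) :
    ∃ i < n, ∃ j < n, ∃ s₁ < n + 1, ∃ s₂ < n + 1, Positive n A i j s₁ s₂ := by
  by_contra! hc
  have hreach : ∀ (i j : Fin n) l a, LWalk (StaticE L C R) l i a j →
      reachValue n A i j (2 * n + 2) = 0 := by
    intro i j l a p
    -- Only the existence of a connecting walk matters, so it may be shortened without regard to its
    -- label until the array records it.
    obtain ⟨m, hm, ⟨s, w⟩, q, -⟩ := p.exists_short (P := fun _ => True) trivial (by simp) (by simp)
    rw [Fintype.card_fin] at hm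
    have hs := q.natAbs_fst_le fun _ _ _ => StaticE.natAbs_le
    simp only at hs
    refine if_pos ⟨(s + (n + 1)).toNat, by omega, ?_⟩
    exact ne_bot_of_le_ne_bot WithBot.coe_ne_bot (hA m hm.le i j s w q)
  refine not_infWeightNPath ?_ ?_ h
  · intro l hl i w p
    have h1 := hA l hl i i 0 w p
    -- The choice `i = j`, `s₁ = 0`, `s₂ = 1` tests a closed walk of shift zero by itself.
    have h2 := hc i i.2 i i.2 0 (by omega) 1 (by have := i.2; omega)
    rw [Positive, hreach i i l _ p, zero_add, one_nsmul, zero_nsmul, add_zero, not_lt] at h2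
    have e : ((0 : ℤ) + (n + 1)).toNat = 0 + (n + 1) := by omega
    rw [e] at h1
    exact_mod_cast h1.trans h2
  · intro i j l a p l₁ hl₁ l₂ hl₂ s₁ s₂ hs₁ hs₂ w₁ w₂ p₁ p₂
    have hb₁ := p₁.natAbs_fst_le fun _ _ _ => StaticE.natAbs_le
    have hb₂ := p₂.natAbs_fst_le fun _ _ _ => StaticE.natAbs_le
    simp only at hb₁ hb₂
    lift s₁ to ℕ using hs₁.le
    lift s₂ to ℕ using hs₂.le
    have h1 := hA l₁ hl₁ i i _ _ p₁
    have h2 := hA l₂ hl₂ j j _ _ p₂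
    have h3 := hc i i.2 j j.2 s₁ (by omega) s₂ (by omega)
    rw [Positive, hreach i j l _ p, zero_add, not_lt] at h3
    have e1 : ((s₁ : ℤ) + (n + 1)).toNat = s₁ + (n + 1) := by omega
    have e2 : (-(s₂ : ℤ) + (n + 1)).toNat = n + 1 - s₂ := by omega
    rw [e1] at h1
    rw [e2] at h2
    -- The recorded entries dominate `w₁` and `w₂`, so nonpositivity passes from them to the walks.
    have h4 := (add_le_add (nsmul_le_nsmul_right h1 s₂) (nsmul_le_nsmul_right h2 s₁)).trans h3
    rw [← WithBot.coe_nsmul, ← WithBot.coe_nsmul, ← WithBot.coe_add, nsmul_eq_mul,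
      nsmul_eq_mul] at h4
    exact_mod_cast h4

end Criterion

/-- The value of `reachValue`, in the cell of the array `7`. -/
def computeReach : Prog :=
  .seq (.cellBot ⟨7, 2, 2⟩) (.for 10 7 (.seq (.mul 11 10 0 12) (.seq (.regAdd 11 11 8)
    (.ite (.cellLe ⟨3, 11, 9⟩ ⟨8, 2, 2⟩) .skip (.cellZero ⟨7, 2, 2⟩)))))

/-- Add the cell `x` to the accumulator, as often as register `N` says. -/
def addTimes (N : ℕ) (x : Cell) : Prog :=
  .for 15 N (.cellAdd ⟨4, 2, 2⟩ ⟨4, 2, 2⟩ x)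

/-- Raise the flag, the cell of the array `6`, if the combination is positive. -/
def testPositive : Prog :=
  .seq (.regAdd 12 10 3) (.seq (.mul 13 12 0 14) (.seq (.regAdd 13 13 8)
    (.seq (.regSub 12 3 11) (.seq (.mul 14 12 0 15) (.seq (.regAdd 14 14 9)
      (.seq (.cellCopy ⟨4, 2, 2⟩ ⟨7, 2, 2⟩) (.seq (addTimes 11 ⟨3, 13, 8⟩)
        (.seq (addTimes 10 ⟨3, 14, 9⟩)
          (.ite (.cellLe ⟨4, 2, 2⟩ ⟨5, 2, 2⟩) .skip (.cellZero ⟨6, 2, 2⟩))))))))))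

/-- Raise the flag if one of the combinations is positive. -/
def testAll : Prog :=
  .for 8 0 (.for 9 0 (.seq computeReach (.for 10 3 (.for 11 3 testPositive))))

/-- The array `3` holds the weights `A`, and the cells of the arrays `5` and `8` hold `0` and
`-∞`. -/
def Ready (A : ℕ → ℕ → WithBot ℝ) (a : Arrays) : Prop :=
  a 3 = A ∧ a 5 0 0 = 0 ∧ a 8 0 0 = ⊥

section Evaluate

variable {n : ℕ} {A : ℕ → ℕ → WithBot ℝ}

theorem computeReach_does (hn : 1 ≤ n) {σ : Memory} (hσ : Regs n σ) (hA : Ready A σ.arr) {i j : ℕ}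
    (hi : σ.reg 8 = i) (hj : σ.reg 9 = j) :
    Does computeReach σ (77 * n ^ 2) fun τ => Agree 10 σ τ ∧ Ready A τ.arr ∧
      τ.arr 6 = σ.arr 6 ∧ τ.arr 7 0 0 = reachValue n A i j (2 * n + 2) := by
  have e : (2 * n + 2) * (n * 4 + 5 + (1 + (1 + 1) + 1) + 1 + 3) + 3 ≤ 75 * n ^ 2 :=
    loop_time_le (b := 4) (e := 1) (c := 15) (d := 1) hn (by rw [pow_one]; omega)
      (by rw [pow_one]; omega)
  have hn2 : 1 ≤ n ^ 2 := Nat.one_le_pow _ _ hn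
  refine (Does.seq (T := 1)
    (T' := (2 * n + 2) * (n * 4 + 5 + (1 + (1 + 1) + 1) + 1 + 3) + 3) (Does.cellBot ((Does.for
    (σ := σ.set ⟨7, 2, 2⟩ ⊥) (n := 2 * n + 2) (T := n * 4 + 5 + (1 + (1 + 1) + 1) + 1)
    (fun m a => Ready A a ∧ a 6 = σ.arr 6 ∧ a 7 0 0 = reachValue n A i j m)
    hσ.r1 (by omega) (by omega) hσ.r7 ?_ ?_).mono le_rfl ?_))).le (by omega)
  · refine ⟨⟨?_, ?_, ?_⟩, ?_, ?_⟩
    · rw [Memory.set_arr_of_ne _ _ _ (by simp), hA.1]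
    · rw [Memory.set_arr_of_ne _ _ _ (by simp), hA.2.1]
    · rw [Memory.set_arr_of_ne _ _ _ (by simp), hA.2.2]
    · rw [Memory.set_arr_of_ne _ _ _ (by simp)]
    · rw [Memory.set_arr_name _ ⟨7, 2, 2⟩]
      simp [hσ.r2, reachValue]
  · rintro s hs τ ha hτ10 ⟨hAτ, h6, h7⟩
    replace ha : Agree 10 σ τ := ha
    have hτ := hσ.agree ha (by omega)
    refine Does.seq (T := n * 4 + 5) (T' := 1 + (1 + 1) + 1) (Does.mul hτ.r1
      (by omega) (by omega) (by omega) (by omega) (by omega)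
      (by omega) (by omega) hτ.r0 (Does.seq (Does.regAdd ?_)))
    set υ := ((τ.setReg 11 (τ.reg 10 * n)).setReg 12 n).setReg 11
      (((τ.setReg 11 (τ.reg 10 * n)).setReg 12 n).reg 11 +
        ((τ.setReg 11 (τ.reg 10 * n)).setReg 12 n).reg 8) with hυdef
    have haυ : Agree 11 τ υ := (((Agree.refl _ _).setReg (by omega) _).setReg (by omega) _).setReg
      (by omega) _
    have hυ := hτ.agree haυ (by omega)
    have hυ9 : υ.reg 9 = j := by rw [haυ _ (by omega), ha _ (by omega), hj]
    have hυ11 : υ.reg 11 = s * n + i := by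
      simp [hυdef, Memory.setReg_reg_of_ne, hτ10, ha 8 (by omega), hi]
    have hυarr : υ.arr = τ.arr := rfl
    refine Does.ite ?_ ?_
    · intro hle
      simp only [Test.Holds, Memory.get, hυ9, hυ11, hυarr, hυ.r2, hAτ.1, hAτ.2.2,
        le_bot_iff] at hle
      refine Does.skip ⟨haυ, hAτ, h6, ?_⟩
      rw [hυarr, h7, reachValue, reachValue]
      refine if_congr ⟨?_, ?_⟩ rfl rfl
      · rintro ⟨t, ht, h⟩
        exact ⟨t, by omega, h⟩
      · rintro ⟨t, ht, h⟩
        rcases Nat.lt_succ_iff_lt_or_eq.1 ht with h' | rfl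
        · exact ⟨t, h', h⟩
        · exact absurd hle h
    · intro hle
      simp only [Test.Holds, Memory.get, hυ9, hυ11, hυarr, hυ.r2, hAτ.1, hAτ.2.2,
        le_bot_iff] at hle
      refine Does.cellZero ⟨haυ.set _ _, ⟨?_, ?_, ?_⟩, ?_, ?_⟩
      · rw [Memory.set_arr_of_ne _ _ _ (by simp)]; exact hAτ.1
      · rw [Memory.set_arr_of_ne _ _ _ (by simp)]; exact hAτ.2.1
      · rw [Memory.set_arr_of_ne _ _ _ (by simp)]; exact hAτ.2.2
      · rw [Memory.set_arr_of_ne _ _ _ (by simp)]; exact h6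
      · have hv : reachValue n A i j (s + 1) = 0 := if_pos ⟨s, by omega, hle⟩
        rw [Memory.set_arr_name _ ⟨7, 2, 2⟩, hv]
        simp [hυ.r2]
  · rintro τ ⟨ha, h⟩
    exact ⟨ha, h⟩

/-- Repeated addition agrees with `•` also for `m = 0` and `x = -∞`: the accumulator is then left as
it is. -/
theorem addTimes_does {σ : Memory} (hσ : Regs n σ) {N m : ℕ} {x : Cell} (hN : N < 15)
    (hm : σ.reg N = m) (hx : x.name ≠ 4) (hr : x.row < 15) (hc : x.col < 15) :
    Does (addTimes N x) σ (m * (1 + 3) + 3) fun τ => Agree 15 σ τ ∧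
      (∀ y, y ≠ 4 → τ.arr y = σ.arr y) ∧ τ.arr 4 0 0 = σ.arr 4 0 0 + m • σ.get x := by
  refine Does.for (fun t a => (∀ y, y ≠ 4 → a y = σ.arr y) ∧
    a 4 0 0 = σ.arr 4 0 0 + t • σ.get x) hσ.r1 (by omega) hN hm
    ⟨fun _ _ => rfl, by simp⟩ ?_
  rintro t ht τ ha - ⟨hy, h4⟩
  have hτ := hσ.agree ha (by omega)
  have hx' : τ.get x = σ.get x := by simp only [Memory.get, hy _ hx, ha _ hr, ha _ hc]
  refine Does.cellAdd ⟨Agree.set (Agree.refl _ _) _ _, fun y hy4 => ?_, ?_⟩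
  · rw [Memory.set_arr_of_ne _ _ _ hy4, hy y hy4]
  · rw [Memory.set_arr_name _ ⟨4, 2, 2⟩, hx', succ_nsmul, ← add_assoc, ← h4]
    simp [hτ.r2, Memory.get]

theorem testPositive_does (hn : 1 ≤ n) {σ : Memory} (hσ : Regs n σ) (hA : Ready A σ.arr)
    {i j s₁ s₂ : ℕ} (hi : σ.reg 8 = i) (hj : σ.reg 9 = j) (h1 : σ.reg 10 = s₁)
    (h2 : σ.reg 11 = s₂) (hs₁ : s₁ < n + 1) (hs₂ : s₂ < n + 1)
    (h7 : σ.arr 7 0 0 = reachValue n A i j (2 * n + 2)) :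
    Does testPositive σ (50 * n) fun τ => Agree 12 σ τ ∧
      (Ready A τ.arr ∧ τ.arr 7 0 0 = reachValue n A i j (2 * n + 2)) ∧
      (τ.arr 6 0 0 ≠ ⊥ ↔ σ.arr 6 0 0 ≠ ⊥ ∨ Positive n A i j s₁ s₂) := by
  refine Does.le (T := 1 + (n * 4 + 5 + (1 + (1 + (n * 4 + 5 + (1 + (1 + ((s₂ * (1 + 3) + 3) +
    ((s₁ * (1 + 3) + 3) + (1 + 1) + 1) + 1) + 1) + 1) + 1) + 1) + 1) + 1) + 1) ?_ (by omega)
  refine Does.seq (Does.regAdd (Does.seq (Does.mul (n := n) ?_ (by omega) (by omega) (by omega)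
    (by omega) (by omega) (by omega) (by omega) ?_ (Does.seq (Does.regAdd (Does.seq (Does.regSub
    (Does.seq (Does.mul (n := n) ?_ (by omega) (by omega) (by omega)
    (by omega) (by omega) (by omega) (by omega) ?_
    (Does.seq (Does.regAdd (Does.seq (Does.cellCopy ?_)))))))))))))
  · simp [Memory.setReg_reg_of_ne, hσ.r1]
  · simp [Memory.setReg_reg_of_ne, hσ.r0]
  · simp [Memory.setReg_reg_of_ne, hσ.r1]
  · simp [Memory.setReg_reg_of_ne, hσ.r0]
  -- All that matters of the address computation is the two row indices in registers `13` and `14`,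
  -- the unchanged arrays and the registers below `12`.
  generalize hτdef : Memory.setReg _ 14 _ = τ
  have hτ14 : τ.reg 14 = (n + 1 - s₂) * n + j := by
    rw [← hτdef]
    simp [Memory.setReg_reg_of_ne, hσ.r3, h2, hj]
  have hτ13 : τ.reg 13 = (s₁ + (n + 1)) * n + i := by
    rw [← hτdef]
    simp [Memory.setReg_reg_of_ne, hσ.r3, h1, hi]
  have hτarr : τ.arr = σ.arr := by
    rw [← hτdef]
    rfl
  have ha : Agree 12 σ τ := by
    rw [← hτdef]
    repeat refine Agree.setReg ?_ (by omega) _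
    exact Agree.refl _ _
  clear hτdef
  have hτ := hσ.agree ha (by omega)
  generalize hυdef : τ.set _ _ = υ
  have hυreg : υ.reg = τ.reg := by rw [← hυdef]; rfl
  have hυ : Regs n υ := hτ.agree (b := 8) (fun r _ => by rw [hυreg]) le_rfl
  have hυarr : ∀ y, y ≠ 4 → υ.arr y = σ.arr y := fun y hy => by
    rw [← hυdef, Memory.set_arr_of_ne _ _ _ hy, hτarr]
  have hυ4 : υ.arr 4 0 0 = reachValue n A i j (2 * n + 2) := by
    rw [← hυdef, Memory.set_arr_name _ ⟨4, 2, 2⟩]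
    simp [hτ.r2, Memory.get, hτarr, h7]
  clear hυdef
  refine Does.seq (T := s₂ * (1 + 3) + 3) (T' := s₁ * (1 + 3) + 3 + (1 + 1) + 1)
    ((addTimes_does hυ (by omega) (m := s₂) (by rw [hυreg, ha _ (by omega), h2])
    (by simp) (by simp) (by simp)).mono le_rfl ?_)
  rintro φ ⟨haφ, hφarr, hφ4⟩
  have hφ := hυ.agree haφ (by omega)
  refine Does.seq (T := s₁ * (1 + 3) + 3) (T' := 1 + 1) ((addTimes_does hφ (by omega) (m := s₁)
    (by rw [haφ _ (by omega), hυreg, ha _ (by omega), h1])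
    (by simp) (by simp) (by simp)).mono le_rfl ?_)
  rintro ψ ⟨haψ, hψarr, hψ4⟩
  have hψ := hφ.agree haψ (by omega)
  have hψarr' : ∀ y, y ≠ 4 → ψ.arr y = σ.arr y := fun y hy => by
    rw [hψarr y hy, hφarr y hy, hυarr y hy]
  have hg1 : υ.get ⟨3, 13, 8⟩ = A ((s₁ + (n + 1)) * n + i) i := by
    simp only [Memory.get, hυreg, hτ13, ha 8 (by omega), hi, hυarr 3 (by omega), hA.1]
  have hg2 : φ.get ⟨3, 14, 9⟩ = A ((n + 1 - s₂) * n + j) j := by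
    simp only [Memory.get, haφ 14 (by omega), haφ 9 (by omega), hυreg, hτ14, ha 9 (by omega), hj,
      hφarr 3 (by omega), hυarr 3 (by omega), hA.1]
  have haσψ : Agree 12 σ ψ := ((ha.trans fun r _ => by rw [hυreg]).trans
    (haφ.anti (by omega))).trans (haψ.anti (by omega))
  rw [hφ4, hυ4, hg1, hg2] at hψ4
  have hready : Ready A ψ.arr := ⟨(hψarr' 3 (by omega)).trans hA.1,
    by rw [hψarr' 5 (by omega), hA.2.1], by rw [hψarr' 8 (by omega), hA.2.2]⟩
  have hψ7 : ψ.arr 7 0 0 = reachValue n A i j (2 * n + 2) := by rw [hψarr' 7 (by omega), h7]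
  refine Does.ite ?_ ?_
  · intro hle
    simp only [Test.Holds, Memory.get, hψ.r2, hψ4, hready.2.1] at hle
    refine Does.skip ⟨haσψ, ⟨hready, hψ7⟩, ?_⟩
    rw [hψarr' 6 (by omega), Positive, or_iff_left hle.not_gt]
  · intro hle
    simp only [Test.Holds, Memory.get, hψ.r2, hψ4, hready.2.1, not_le] at hle
    refine Does.cellZero ⟨haσψ.set _ _, ⟨⟨?_, ?_, ?_⟩, ?_⟩, ?_⟩
    · rw [Memory.set_arr_of_ne _ _ _ (by simp)]; exact hready.1
    · rw [Memory.set_arr_of_ne _ _ _ (by simp)]; exact hready.2.1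
    · rw [Memory.set_arr_of_ne _ _ _ (by simp)]; exact hready.2.2
    · rw [Memory.set_arr_of_ne _ _ _ (by simp)]; exact hψ7
    · rw [Memory.set_arr_name _ ⟨6, 2, 2⟩]
      simp [hψ.r2, Positive, hle]

/-- Reachability depends on `i` and `j` only and is computed outside the two inner loops; a pair
then costs `O(n^2)` for it and `O(n^3)` for all `s₁, s₂`. -/
theorem testAll_does (hn : 1 ≤ n) {σ : Memory} (hσ : Regs n σ) (hA : Ready A σ.arr) :
    Does testAll σ (400 * n ^ 5) fun τ => Agree 8 σ τ ∧ Ready A τ.arr ∧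
      (τ.arr 6 0 0 ≠ ⊥ ↔ σ.arr 6 0 0 ≠ ⊥ ∨
        ∃ i < n, ∃ j < n, ∃ s₁ < n + 1, ∃ s₂ < n + 1, Positive n A i j s₁ s₂) := by
  have e1 : (n + 1) * (50 * n + 3) + 3 ≤ 109 * n ^ 2 :=
    loop_time_le (b := 2) (e := 1) (c := 50) (d := 1) hn (by rw [pow_one]; omega) (by rw [pow_one])
  have e2 : (n + 1) * ((n + 1) * (50 * n + 3) + 3 + 3) + 3 ≤ 227 * n ^ 3 :=
    loop_time_le (b := 2) (e := 1) hn (by rw [pow_one]; omega) e1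
  have e3 : 77 * n ^ 2 + ((n + 1) * ((n + 1) * (50 * n + 3) + 3 + 3) + 3) + 1 ≤ 305 * n ^ 3 := by
    have h1 : n ^ 2 ≤ n ^ 3 := Nat.pow_le_pow_right hn (by omega)
    have h2 : 1 ≤ n ^ 3 := Nat.one_le_pow _ _ hn
    omega
  have e4 := loop_time_le (N := n) (b := 1) (e := 1) hn (by simp) e3
  have e5 := loop_time_le (N := n) (b := 1) (e := 1) hn (by simp) e4
  refine (Does.for_exists (Ready A) (fun a => a 6 0 0 ≠ ⊥)
    (fun i => ∃ j < n, ∃ s₁ < n + 1, ∃ s₂ < n + 1, Positive n A i j s₁ s₂)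
    hσ.r1 (by omega) (by omega) hσ.r0 hA ?_).le
    (e5.trans (Nat.mul_le_mul_right _ (by norm_num)))
  intro i hi τ haτ hτ8 hAτ
  have hτ := hσ.agree haτ (by omega)
  refine Does.for_exists (Ready A) (fun a => a 6 0 0 ≠ ⊥)
    (fun j => ∃ s₁ < n + 1, ∃ s₂ < n + 1, Positive n A i j s₁ s₂)
    hτ.r1 (by omega) (by omega) hτ.r0 hAτ ?_
  intro j hj υ haυ hυ9 hAυ
  have hυ := hτ.agree haυ (by omega)
  have hυ8 : υ.reg 8 = i := by rw [haυ _ (by omega), hτ8]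
  refine Does.seq ((computeReach_does hn hυ hAυ hυ8 hυ9).mono le_rfl ?_)
  rintro φ ⟨haφ, hAφ, hφ6, hφ7⟩
  have hφ := hυ.agree haφ (by omega)
  refine (Does.for_exists
    (fun a => Ready A a ∧ a 7 0 0 = reachValue n A i j (2 * n + 2)) (fun a => a 6 0 0 ≠ ⊥)
    (fun s₁ => ∃ s₂ < n + 1, Positive n A i j s₁ s₂)
    hφ.r1 (by omega) (by omega) hφ.r3 ⟨hAφ, hφ7⟩ ?_).mono le_rfl
    fun ω hω => ⟨haφ.trans hω.1, hω.2.1.1, by rw [hω.2.2, hφ6]⟩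
  intro s₁ hs₁ ψ haψ hψ10 hAψ
  have hψ := hφ.agree haψ (by omega)
  refine Does.for_exists
    (fun a => Ready A a ∧ a 7 0 0 = reachValue n A i j (2 * n + 2)) (fun a => a 6 0 0 ≠ ⊥)
    (fun s₂ => Positive n A i j s₁ s₂)
    hψ.r1 (by omega) (by omega) hψ.r3 hAψ ?_
  intro s₂ hs₂ ω haω hω11 hAω
  have hω := hψ.agree haω (by omega)
  refine testPositive_does hn hω hAω.1 ?_ ?_ ?_ hω11 hs₁ hs₂ hAω.2
  · rw [haω _ (by omega), haψ _ (by omega), haφ _ (by omega), hυ8]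
  · rw [haω _ (by omega), haψ _ (by omega), haφ _ (by omega), hυ9]
  · rw [haω _ (by omega), hψ10]

end Evaluate

/-! ## The program -/

/-- Fill the index registers with constants, and the cell of the array `5` with `0`. -/
def setup : Prog :=
  .seq (.regConst 1 1) (.seq (.regAdd 3 0 1) (.seq (.mul 4 3 0 8) (.seq (.regAdd 5 3 0)
    (.seq (.mul 6 5 0 8) (.seq (.regAdd 7 3 3) (.cellZero ⟨5, 2, 2⟩))))))

/-- The program that decides whether there is an infinite-weight path. -/
def decideInfWeight : Prog :=
  .seq setup (.seq computeWalks (.seq testAll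
    (.ite (.cellLe ⟨6, 2, 2⟩ ⟨8, 2, 2⟩) (.regConst 0 0) (.regConst 0 1))))

section Main

variable {n : ℕ} (L C R : RmaxMatrix n)

theorem holdsInstance {Y : Arrays} (hY : ∀ y < 3, Y y = (initMemory L C R).arr y) :
    HoldsInstance L C R Y := by
  intro x j k hx
  rw [hY x hx]
  interval_cases x <;> simp [initMemory, shiftMatrix]

theorem setup_does (hn : 1 ≤ n) :
    Does setup (initMemory L C R) (30 * n) fun σ => Regs n σ ∧ HoldsInstance L C R σ.arr ∧
      Good L C R σ.arr σ.arr ∧ σ.arr 5 0 0 = 0 ∧ σ.arr 6 0 0 = ⊥ ∧ σ.arr 8 0 0 = ⊥ := by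
  refine Does.le (T := 1 + (1 + (n * 4 + 5 + (1 + (n * 4 + 5 + (1 + 1 + 1) + 1) + 1) + 1) + 1) + 1)
    ?_ (by omega)
  refine Does.seq (Does.regConst (Does.seq (Does.regAdd (Does.seq
    (T := n * 4 + 5) (T' := 1 + (n * 4 + 5 + (1 + 1 + 1) + 1) + 1)
    (Does.mul (n := n) ?_ (by omega)
    (by omega) (by omega) (by omega) (by omega) (by omega) (by omega) ?_ (Does.seq (Does.regAdd
    (Does.seq (T := n * 4 + 5) (T' := 1 + 1 + 1)
    (Does.mul (n := n) ?_ (by omega) (by omega) (by omega) (by omega) (by omega)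
    (by omega) (by omega) ?_ (Does.seq (Does.regAdd (Does.cellZero ?_))))))))))))
  · simp [Memory.setReg_reg_of_ne]
  · simp [Memory.setReg_reg_of_ne, initMemory]
  · simp [Memory.setReg_reg_of_ne]
  · simp [Memory.setReg_reg_of_ne, initMemory]
  generalize hτdef : Memory.setReg _ 7 _ = τ
  have hτarr : τ.arr = (initMemory L C R).arr := by
    rw [← hτdef]
    rfl
  have hτ : Regs n τ := by
    rw [← hτdef]
    constructor <;> simp [Memory.setReg_reg_of_ne, initMemory] <;> omega
  have h2 := hτ.r2
  clear hτdef
  have hne : ∀ y, y ≠ 5 → (τ.set ⟨5, 2, 2⟩ 0).arr y = (initMemory L C R).arr y := fun y hy => by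
    rw [Memory.set_arr_of_ne _ _ _ hy, hτarr]
  refine ⟨hτ.agree (b := 8) (fun _ _ => rfl) le_rfl,
    holdsInstance L C R fun y hy => hne y (by omega), ⟨fun _ _ _ => rfl, ?_⟩, ?_, ?_, ?_⟩
  -- Array `3` initially holds only `-∞`, so soundness is vacuous.
  · rw [hne 3 (by omega)]
    intro q j w h
    simp [initMemory] at h
  · rw [Memory.set_arr_name _ ⟨5, 2, 2⟩]
    simp [h2]
  · rw [hne 6 (by omega)]
    simp [initMemory]
  · rw [hne 8 (by omega)]
    simp [initMemory]

theorem decideInfWeight_does (hn : 1 ≤ n) :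
    Does decideInfWeight (initMemory L C R) (600 * n ^ 5) fun σ =>
      (InfWeightNPath L C R → σ.reg 0 = 1) ∧ (¬ InfWeightNPath L C R → σ.reg 0 = 0) := by
  have h1 : n ≤ n ^ 5 := Nat.le_self_pow (by norm_num) n
  refine Does.le (T := 30 * n + (124 * n ^ 5 + (400 * n ^ 5 + (1 + 1) + 1) + 1) + 1) ?_ (by omega)
  refine Does.seq ((setup_does L C R hn).mono le_rfl ?_)
  rintro σ ⟨hσ, hY, hG, h5, h6, h8⟩
  refine Does.seq ((computeWalks_does hn hY hσ hG).mono le_rfl ?_)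
  rintro τ ⟨haτ, ⟨hGτ, hS⟩, hC⟩
  have hτ := hσ.agree haτ (by omega)
  refine Does.seq ((testAll_does hn hτ (A := τ.arr 3) ⟨rfl, ?_, ?_⟩).mono le_rfl ?_)
  · rw [hGτ 5 (by omega) (by omega), h5]
  · rw [hGτ 8 (by omega) (by omega), h8]
  rintro υ ⟨haυ, hA, hiff⟩
  have hυ := hτ.agree haυ (by omega)
  -- The flag was still `-∞` before the tests, so it is raised exactly when the criterion holds.
  rw [hGτ 6 (by omega) (by omega), h6, ne_eq, ne_eq, eq_self, not_true, false_or] at hiff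
  have key : υ.arr 6 0 0 ≠ ⊥ ↔ InfWeightNPath L C R := by
    refine hiff.trans ⟨?_, exists_positive hC⟩
    rintro ⟨i, hi, j, -, s₁, -, s₂, hs₂, h⟩
    exact infWeightNPath_of_positive hS hi hs₂ h
  have htest : Test.Holds υ (.cellLe ⟨6, 2, 2⟩ ⟨8, 2, 2⟩) ↔ ¬ InfWeightNPath L C R := by
    rw [← key]
    simp [Test.Holds, Memory.get, hυ.r2, hA.2.2]
  refine Does.ite ?_ ?_
  · intro h
    rw [htest] at h
    exact Does.regConst ⟨fun h' => absurd h' h, fun _ => by simp⟩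
  · intro h
    rw [htest, not_not] at h
    exact Does.regConst ⟨fun _ => by simp, fun h' => absurd h h'⟩

theorem decideInfWeight_decidesWithin :
    DecidesWithin decideInfWeight (fun _ L C R => InfWeightNPath L C R) fun n => 600 * n ^ 5 := by
  intro n hn L C R
  obtain ⟨τ, t, ht, hs, h⟩ := decideInfWeight_does L C R hn
  have hrun : run decideInfWeight L C R t = ⟨[], τ⟩ := hs []
  refine ⟨t, ht, ?_⟩
  rw [hrun]
  exact ⟨rfl, h⟩

end Main

end ArithRAM

theorem mainTheorem4 :
    ∃ (P : ArithRAM.Prog) (K : ℕ),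
      ArithRAM.DecidesWithin P (fun _ L C R => InfWeightNPath L C R) (fun n => K * n ^ 5) ∧
      ArithRAM.HasPolynomialNumbers P := by
  exact ⟨ArithRAM.decideInfWeight, 600, ArithRAM.decideInfWeight_decidesWithin,
    ArithRAM.decideInfWeight_decidesWithin.hasPolynomialNumbers⟩
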